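/- Let $k$ be a commutative ring. Let $\Delta S$ be the category with objects $[n]=\{0,1,\dots,n\}$, $n\ge 0$, in which a morphism $f:[m]\to[n]$ is a set function together with a total order on each fibre $f^{-1}(i)$, and in which the composite $gf$ carries on $(gf)^{-1}(i)=\coprod_{j\in g^{-1}(i)}f^{-1}(j)$ the block order determined by the orders on $g^{-1}(i)$ and on the sets $f^{-1}(j)$. For an associative unital $k$-algebra $A$ let $B^{sym}A:\Delta S\to k\text{-modules}$ be the functor with $B^{sym}A([n])=A^{\otimes n+1}$ (tensor product over $k$) and $B^{sym}A(f)(a_0\otimes\dots\otimes a_m)=b_0\otimes\dots\otimes b_n$, where $b_i=\prod_{j\in f^{-1}(i)}a_j$ is the product in the order specified on $f^{-1}(i)$. Let $HS_*(A)=\mathrm{Tor}^{\Delta S}_*(\underline k,B^{sym}A)$, where $\underline k$ is the trivial contravariant functor. Let $L_*(A)$ be the chain complex (with differential the alternating sum of the faces) of the simplicial $k$-module $$L_p(A)=\bigoplus_{[m_0]\xrightarrow{f_1}[m_1]\to\dots\xrightarrow{f_p}[m_p]}A^{\otimes m_0+1}\qquad(p\ge 0),$$ the sum being over all composable chains of $p$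 morphisms of $\Delta S$. The $0$-th face deletes $f_1$ and acts on $A^{\otimes m_0+1}$ by $B^{sym}A(f_1)$, the $p$-th face drops $f_p$, the other faces compose $f_{i+1}$ with $f_i$, and the degeneracies insert identities. **Proposition.** Let $A$ be equipped with an augmentation, that is, a $k$-algebra homomorphism $\varepsilon:A\to k$, and let $I=\ker\varepsilon$. Put $B^{sym}_0I=A$ and $B^{sym}_mI=I^{\otimes m+1}$ for $m>0$. Let $$L^{epi}_p(A)=\bigoplus_{[m_0]\overset{f_1}{\twoheadrightarrow}[m_1]\twoheadrightarrow\dots\overset{f_p}{\twoheadrightarrow}[m_p]}B^{sym}_{m_0}I\qquad(p\ge 0),$$ the sum being over all composable chains of $p$ epimorphisms of $\Delta S$, with faces and degeneracies given by the same formulas. Then the map $L^{epi}_*(A)\to L_*(A)$ induced by the inclusions $I\subset A$ is injective in each degree, so that $L^{epi}_*(A)$ is a subcomplex of $L_*(A)$, and it is a chain homotopy equivalence of complexes of $k$-modules. Consequently $HS_n(A)\cong H_n(L^{epi}_*(A))$ as $k$-modules for every $n\ge 0$. -/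

import Mathlib

open CategoryTheory Opposite
open scoped TensorProduct DirectSum

universe u

namespace SymmetricHomology

/-! ## The category `ΔS` -/

/-- Objects of `ΔS`: the finite ordinals `[n] = {0, 1, …, n}` with `n = X.len ≥ 0`. -/
@[ext]
structure DeltaS : Type where
  /-- The object `[len] = Fin (len + 1)`. -/
  len : ℕ

namespace DeltaS

/-- A morphism `[m] ⟶ [n]` of `ΔS`: a function together with a total order on each of its fibres.
A total order on the finite set `f⁻¹(i)` is recorded as the list of its elements in increasing
order. -/
structure Hom (X Y : DeltaS) : Type where
  /-- The underlying function. -/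
  toFun : Fin (X.len + 1) → Fin (Y.len + 1)
  /-- The elements of the fibre over `i`, listed in the specified order. -/
  fiber : Fin (Y.len + 1) → List (Fin (X.len + 1))
  nodup : ∀ i, (fiber i).Nodup
  mem_fiber : ∀ i j, j ∈ fiber i ↔ toFun j = i

theorem Hom.ext_fiber {X Y : DeltaS} {f g : Hom X Y} (h : f.fiber = g.fiber) : f = g := by
  have h2 : f.toFun = g.toFun := by
    funext j
    have := (f.mem_fiber (f.toFun j) j).2 rfl
    rw [h] at this
    exact ((g.mem_fiber _ _).1 this).symm
  cases f; cases g
  cases h; cases h2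
  rfl

/-- The identity: every fibre is a one-element list. -/
def Hom.id (X : DeltaS) : Hom X X where
  toFun := fun j => j
  fiber := fun i => [i]
  nodup := fun i => List.nodup_singleton i
  mem_fiber := fun i j => by simp

/-- Composition: the fibre of the composite over `i` is the block ordering, i.e. the concatenation
of the fibres of `f` over the elements of the fibre of `g` over `i`, in the order of the latter. -/
def Hom.comp {X Y Z : DeltaS} (f : Hom X Y) (g : Hom Y Z) : Hom X Z where
  toFun := fun j => g.toFun (f.toFun j)
  fiber := fun i => (g.fiber i).flatMap f.fiber
  nodup := fun i => by
    rw [List.nodup_flatMap]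
    refine ⟨fun j _ => f.nodup j, (g.nodup i).imp fun {a b} hab x hxa hxb => hab ?_⟩
    rw [← (f.mem_fiber a x).1 hxa, ← (f.mem_fiber b x).1 hxb]
  mem_fiber := fun i j => by
    simp [List.mem_flatMap, g.mem_fiber, f.mem_fiber]

instance : SmallCategory DeltaS where
  Hom := Hom
  id := Hom.id
  comp := Hom.comp
  id_comp f := Hom.ext_fiber (by funext i; simp [Hom.comp, Hom.id])
  comp_id f := Hom.ext_fiber (by funext i; simp [Hom.comp, Hom.id])
  assoc f g h := Hom.ext_fiber (by funext i; simp [Hom.comp, List.flatMap_assoc])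

theorem fiber_id (X : DeltaS) (i : Fin (X.len + 1)) : Hom.fiber (𝟙 X) i = [i] := rfl

theorem fiber_comp {X Y Z : DeltaS} (f : X ⟶ Y) (g : Y ⟶ Z) (i : Fin (Z.len + 1)) :
    Hom.fiber (f ≫ g) i = (Hom.fiber g i).flatMap (Hom.fiber f) := rfl

/-- Epimorphisms of `ΔS` are surjective, so that all their fibres are non-empty. -/
theorem fiber_ne_nil_of_epi {X Y : DeltaS} (f : X ⟶ Y) [Epi f] (i : Fin (Y.len + 1)) :
    Hom.fiber f i ≠ [] := by
  intro hi
  let g : Y ⟶ DeltaS.mk 1 :=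
    { toFun := fun _ => 0
      fiber := fun t => if t = 0 then List.finRange _ else []
      nodup := fun t => by split_ifs <;> simp [List.nodup_finRange]
      mem_fiber := fun t j => by split_ifs with h <;> simp [h, eq_comm] }
  let h : Y ⟶ DeltaS.mk 1 :=
    { toFun := fun j => if j = i then 1 else 0
      fiber := fun t => (List.finRange _).filter fun j => (if j = i then 1 else 0) = t
      nodup := fun t => (List.nodup_finRange _).filter _
      mem_fiber := fun t j => by simp }
  have key : ∀ l : List (Fin (Y.len + 1)),
      (l.filter fun j => (if j = i then (1 : Fin 2) else 0) = 0).flatMap (Hom.fiber f) =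
        l.flatMap (Hom.fiber f) := by
    intro l
    induction l with
    | nil => rfl
    | cons a l ih =>
      by_cases ha : a = i
      · subst ha; simpa [hi] using ih
      · simpa [ha] using ih
  have key1 : ∀ l : List (Fin (Y.len + 1)),
      (l.filter fun j => (if j = i then (1 : Fin 2) else 0) = 1).flatMap (Hom.fiber f) = [] := by
    intro l
    rw [List.flatMap_eq_nil_iff]
    intro x hx
    have : x = i := by
      by_contra hne
      simp [hne] at hx
    rw [this, hi]
  have hgh : f ≫ g = f ≫ h := by
    apply Hom.ext_fiber
    funext t
    rw [fiber_comp, fiber_comp]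
    obtain rfl | rfl : t = 0 ∨ t = 1 := by
      revert t; change ∀ t : Fin 2, _; decide
    · exact (key _).symm
    · exact (key1 _).symm
  have := congrArg (fun φ => Hom.toFun φ i) ((cancel_epi f).1 hgh)
  simp [g, h] at this

end DeltaS

/-- The subcategory of `ΔS` with the same objects, whose morphisms are the epimorphisms of `ΔS`. -/
abbrev EpiDeltaS : Type := WideSubcategory (MorphismProperty.epimorphisms DeltaS)

/-! ## The symmetric bar construction -/

section ListProd

variable {ι R : Type*} [DecidableEq ι] [Monoid R]

theorem prod_map_update_of_notMem {l : List ι} {j : ι} (hj : j ∉ l) (a : ι → R) (x : R) :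
    (l.map (Function.update a j x)).prod = (l.map a).prod := by
  congr 1
  refine List.map_congr_left fun b hb => Function.update_of_ne ?_ _ _
  rintro rfl
  exact hj hb

theorem exists_prod_map_update {l : List ι} (hl : l.Nodup) {j : ι} (hj : j ∈ l) (a : ι → R) :
    ∃ P Q : R, ∀ x, (l.map (Function.update a j x)).prod = P * x * Q := by
  obtain ⟨s, t, rfl⟩ := List.append_of_mem hj
  rw [List.nodup_append, List.nodup_cons] at hl
  refine ⟨(s.map a).prod, (t.map a).prod, fun x => ?_⟩
  have hs : j ∉ s := fun h => hl.2.2 j h j List.mem_cons_self rfl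
  rw [List.map_append, List.map_cons, List.prod_append, List.prod_cons,
    prod_map_update_of_notMem hs, prod_map_update_of_notMem hl.2.1.1, Function.update_self,
    mul_assoc]

end ListProd

theorem prod_map_flatMap {ι κ R : Type*} [Monoid R] (l : List κ) (g : κ → List ι) (a : ι → R) :
    ((l.flatMap g).map a).prod = (l.map fun i => ((g i).map a).prod).prod := by
  induction l with
  | nil => rfl
  | cons b l ih => simp [ih]

section Multilinear

variable {k A M N : Type*} [CommRing k] [Ring A] [Algebra k A] [AddCommGroup M] [Module k M]
  [AddCommGroup N] [Module k N]

/-- Let `f : [m] ⟶ [n]` be a morphism of `ΔS`. If `b(a)ᵢ = ∏_{j ∈ f⁻¹(i)} aⱼ`, the product being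
taken in the order specified on `f⁻¹(i)`, then `(a₀, …, aₘ) ↦ b(a)₀ ⊗ ⋯ ⊗ b(a)ₙ` is multilinear.
The `aⱼ` lie in a module `M` mapping to `A`, the `b(a)ᵢ` in a module `N` embedded in `A`. -/
noncomputable def fiberProd {X Y : DeltaS} (f : X ⟶ Y) (φ : M →ₗ[k] A) (ψ : N →ₗ[k] A)
    (hψ : Function.Injective ψ) (b : (Fin (X.len + 1) → M) → Fin (Y.len + 1) → N)
    (hb : ∀ a i, ψ (b a i) = ((DeltaS.Hom.fiber f i).map fun j => φ (a j)).prod) :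
    MultilinearMap k (fun _ : Fin (X.len + 1) => M) (⨂[k] _ : Fin (Y.len + 1), N) :=
  have aux : ∀ [DecidableEq (Fin (X.len + 1))] (a : Fin (X.len + 1) → M) (j : Fin (X.len + 1)),
      ∃ (c : Fin (Y.len + 1) → N) (P Q : A), ∀ x : M, ∃ y : N, ψ y = P * φ x * Q ∧
        b (Function.update a j x) = Function.update c (DeltaS.Hom.toFun f j) y := by
    intro _ a j
    have hu : ∀ x : M, (fun t => φ (Function.update a j x t)) =
        Function.update (fun t => φ (a t)) j (φ x) := by
      intro x; funext t
      by_cases ht : t = j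
      · subst ht; simp
      · simp [ht]
    obtain ⟨P, Q, hPQ⟩ := exists_prod_map_update (DeltaS.Hom.nodup f (DeltaS.Hom.toFun f j))
      ((DeltaS.Hom.mem_fiber f _ j).2 rfl) (fun t => φ (a t))
    refine ⟨b a, P, Q, fun x => ⟨b (Function.update a j x) (DeltaS.Hom.toFun f j), ?_, ?_⟩⟩
    · rw [hb, hu, hPQ]
    · funext i
      by_cases hi : i = DeltaS.Hom.toFun f j
      · subst hi
        rw [Function.update_self]
      · rw [Function.update_of_ne hi]
        apply hψ
        rw [hb, hb, hu, prod_map_update_of_notMem]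
        intro hmem
        exact hi ((DeltaS.Hom.mem_fiber f i j).1 hmem).symm
  { toFun := fun a => PiTensorProduct.tprod k (b a)
    map_update_add' := by
      intro _ a j x y
      obtain ⟨c, P, Q, h⟩ := aux a j
      obtain ⟨x', hx, ex⟩ := h x
      obtain ⟨y', hy, ey⟩ := h y
      obtain ⟨z', hz, ez⟩ := h (x + y)
      rw [ex, ey, ez, ← MultilinearMap.map_update_add]
      congr 2
      apply hψ
      rw [map_add, hx, hy, hz, map_add, mul_add, add_mul]
    map_update_smul' := by
      intro _ a j r x
      obtain ⟨c, P, Q, h⟩ := aux a j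
      obtain ⟨x', hx, ex⟩ := h x
      obtain ⟨z', hz, ez⟩ := h (r • x)
      rw [ex, ez, ← MultilinearMap.map_update_smul]
      congr 2
      apply hψ
      rw [map_smul, hx, hz, map_smul, mul_smul_comm, smul_mul_assoc] }

@[simp]
theorem fiberProd_apply {X Y : DeltaS} (f : X ⟶ Y) (φ : M →ₗ[k] A) (ψ : N →ₗ[k] A)
    (hψ : Function.Injective ψ) (b : (Fin (X.len + 1) → M) → Fin (Y.len + 1) → N)
    (hb : ∀ a i, ψ (b a i) = ((DeltaS.Hom.fiber f i).map fun j => φ (a j)).prod)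
    (a : Fin (X.len + 1) → M) :
    fiberProd f φ ψ hψ b hb a = PiTensorProduct.tprod k (b a) := rfl

end Multilinear

section Bsym

variable (k A : Type u) [CommRing k] [Ring A] [Algebra k A]

/-- The linear map `A^{⊗ m+1} → A^{⊗ n+1}` given by `a₀ ⊗ ⋯ ⊗ aₘ ↦ b₀ ⊗ ⋯ ⊗ bₙ`, where
`bᵢ = ∏_{j ∈ f⁻¹(i)} aⱼ` in the order specified on `f⁻¹(i)`. -/
noncomputable def bsymMap {X Y : DeltaS} (f : X ⟶ Y) :
    (⨂[k] _ : Fin (X.len + 1), A) →ₗ[k] ⨂[k] _ : Fin (Y.len + 1), A :=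
  PiTensorProduct.lift <| fiberProd f LinearMap.id LinearMap.id Function.injective_id
    (fun a i => ((DeltaS.Hom.fiber f i).map a).prod) (fun _ _ => rfl)

theorem bsymMap_tprod {X Y : DeltaS} (f : X ⟶ Y) (a : Fin (X.len + 1) → A) :
    bsymMap k A f (PiTensorProduct.tprod k a) =
      PiTensorProduct.tprod k fun i => ((DeltaS.Hom.fiber f i).map a).prod := by
  rw [bsymMap, PiTensorProduct.lift.tprod, fiberProd_apply]

/-- The symmetric bar construction `B^sym A : ΔS ⥤ k-Mod`, which takes `[n]` to `A^{⊗ n+1}`. -/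
noncomputable def Bsym : DeltaS ⥤ ModuleCat.{u} k where
  obj X := ModuleCat.of k (⨂[k] _ : Fin (X.len + 1), A)
  map f := ModuleCat.ofHom (bsymMap k A f)
  map_id X := by
    refine ModuleCat.hom_ext (PiTensorProduct.ext (MultilinearMap.ext fun a => ?_))
    change bsymMap k A (𝟙 X) (PiTensorProduct.tprod k a) = PiTensorProduct.tprod k a
    simp [bsymMap_tprod, DeltaS.fiber_id]
  map_comp f g := by
    refine ModuleCat.hom_ext (PiTensorProduct.ext (MultilinearMap.ext fun a => ?_))
    change bsymMap k A (f ≫ g) (PiTensorProduct.tprod k a) =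
      bsymMap k A g (bsymMap k A f (PiTensorProduct.tprod k a))
    simp [bsymMap_tprod, DeltaS.fiber_comp, prod_map_flatMap]

variable {k A} (ε : A →ₐ[k] k)

/-- The augmentation ideal `I = ker ε`, as a `k`-submodule of `A`. -/
def augIdeal : Submodule k A := LinearMap.ker ε.toLinearMap

theorem mul_mem_augIdeal_left {x : A} (hx : x ∈ augIdeal ε) (y : A) : x * y ∈ augIdeal ε := by
  have : ε x = 0 := hx
  change ε (x * y) = 0
  rw [map_mul, this, zero_mul]

theorem list_prod_mem_augIdeal {l : List A} (hne : l ≠ []) (h : ∀ x ∈ l, x ∈ augIdeal ε) :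
    l.prod ∈ augIdeal ε := by
  cases l with
  | nil => exact absurd rfl hne
  | cons x l =>
    rw [List.prod_cons]
    exact mul_mem_augIdeal_left ε (h x List.mem_cons_self) _

/-- The tensor factors of `B^sym_m I`: the whole of `A` if `m = 0`, and `I` if `m > 0`. -/
def bsymFactor (m : ℕ) : Submodule k A := if m = 0 then ⊤ else augIdeal ε

theorem prod_mem_bsymFactor {X Y : DeltaS} (f : X ⟶ Y) [Epi f]
    (a : Fin (X.len + 1) → bsymFactor ε X.len) (i : Fin (Y.len + 1)) :
    ((DeltaS.Hom.fiber f i).map fun j => (a j : A)).prod ∈ bsymFactor ε Y.len := by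
  by_cases hY : Y.len = 0
  · simp [bsymFactor, hY]
  · have hX : X.len ≠ 0 := by
      intro hX
      have hsurj : Function.Surjective (DeltaS.Hom.toFun f) := fun t => by
        obtain ⟨j, hj⟩ := List.exists_mem_of_ne_nil _ (DeltaS.fiber_ne_nil_of_epi f t)
        exact ⟨j, (DeltaS.Hom.mem_fiber f t j).1 hj⟩
      have := Fintype.card_le_of_surjective _ hsurj
      simp only [Fintype.card_fin] at this
      omega
    have hX' : bsymFactor ε X.len = augIdeal ε := if_neg hX
    have hY' : bsymFactor ε Y.len = augIdeal ε := if_neg hY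
    rw [hY']
    refine list_prod_mem_augIdeal ε ?_ ?_
    · simpa using DeltaS.fiber_ne_nil_of_epi f i
    · intro x hx
      obtain ⟨j, _, rfl⟩ := List.mem_map.1 hx
      exact hX' ▸ (a j).2

/-- The restriction of `B^sym(f)` to `B^sym I`, for an epimorphism `f`. -/
noncomputable def bsymIMap {X Y : DeltaS} (f : X ⟶ Y) [Epi f] :
    (⨂[k] _ : Fin (X.len + 1), bsymFactor ε X.len) →ₗ[k]
      ⨂[k] _ : Fin (Y.len + 1), bsymFactor ε Y.len :=
  PiTensorProduct.lift <| fiberProd f (bsymFactor ε X.len).subtype (bsymFactor ε Y.len).subtype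
    (Submodule.injective_subtype _)
    (fun a i => ⟨((DeltaS.Hom.fiber f i).map fun j => (a j : A)).prod,
      prod_mem_bsymFactor ε f a i⟩) (fun _ _ => by simp only [Submodule.subtype_apply])

theorem bsymIMap_tprod {X Y : DeltaS} (f : X ⟶ Y) [Epi f]
    (a : Fin (X.len + 1) → bsymFactor ε X.len) :
    bsymIMap ε f (PiTensorProduct.tprod k a) = PiTensorProduct.tprod k fun i =>
      (⟨((DeltaS.Hom.fiber f i).map fun j => (a j : A)).prod, prod_mem_bsymFactor ε f a i⟩ :
        bsymFactor ε Y.len) :=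
  PiTensorProduct.lift.tprod _

instance {X Y : EpiDeltaS} (f : X ⟶ Y) : Epi f.hom := f.property

/-- The functor `B^sym I` on epimorphisms of `ΔS`: it takes `[0]` to `A` and `[m]` to `I^{⊗ m+1}`
for `m > 0`, and it acts on morphisms by the formula that defines `B^sym A`. -/
noncomputable def BsymI : EpiDeltaS ⥤ ModuleCat.{u} k where
  obj X := ModuleCat.of k (⨂[k] _ : Fin (X.obj.len + 1), bsymFactor ε X.obj.len)
  map f := ModuleCat.ofHom (bsymIMap ε f.hom)
  map_id X := by
    refine ModuleCat.hom_ext (PiTensorProduct.ext (MultilinearMap.ext fun a => ?_))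
    change bsymIMap ε (𝟙 X.obj) (PiTensorProduct.tprod k a) = PiTensorProduct.tprod k a
    simp [bsymIMap_tprod, DeltaS.fiber_id]
  map_comp f g := by
    refine ModuleCat.hom_ext (PiTensorProduct.ext (MultilinearMap.ext fun a => ?_))
    change bsymIMap ε (f.hom ≫ g.hom) (PiTensorProduct.tprod k a) =
      bsymIMap ε g.hom (bsymIMap ε f.hom (PiTensorProduct.tprod k a))
    simp [bsymIMap_tprod, DeltaS.fiber_comp, prod_map_flatMap]

/-- The natural transformation `B^sym I ⟶ B^sym A` induced by the inclusions of tensor factors. -/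
noncomputable def bsymInclusion :
    BsymI ε ⟶ wideSubcategoryInclusion (MorphismProperty.epimorphisms DeltaS) ⋙ Bsym k A where
  app X := ModuleCat.ofHom <| PiTensorProduct.map fun _ => (bsymFactor ε X.obj.len).subtype
  naturality X Y f := by
    refine ModuleCat.hom_ext (PiTensorProduct.ext (MultilinearMap.ext fun a => ?_))
    change PiTensorProduct.map (fun _ => (bsymFactor ε Y.obj.len).subtype)
        (bsymIMap ε f.hom (PiTensorProduct.tprod k a)) =
      bsymMap k A f.hom
        (PiTensorProduct.map (fun _ => (bsymFactor ε X.obj.len).subtype)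
          (PiTensorProduct.tprod k a))
    simp [bsymIMap_tprod, bsymMap_tprod, PiTensorProduct.map_tprod]

end Bsym

/-! ## The bar complex of a functor -/

section Bar

variable {k : Type u} [CommRing k]

variable {C : Type} [SmallCategory C]

/-- A chain `c₀ ⟶ c₁ ⟶ ⋯ ⟶ c_p` of composable morphisms, pulled back along a monotone map
`θ : {0, …, q} → {0, …, p}`. -/
abbrev chainPullback {S T : SimplexCategory} (θ : S ⟶ T) (σ : ComposableArrows C T.len) :
    ComposableArrows C S.len :=
  θ.toOrderHom.monotone.functor ⋙ σ

/-- The composite `c₀ ⟶ c_{θ(0)}` of morphisms of the chain `σ`. -/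
def chainStep {S T : SimplexCategory} (θ : S ⟶ T) (σ : ComposableArrows C T.len) :
    σ.obj 0 ⟶ (chainPullback θ σ).obj 0 :=
  σ.map (homOfLE (Fin.zero_le (θ.toOrderHom 0)))

open Classical in
/-- The simplicial structure of the bar construction: a monotone map `θ` sends the summand `F(c₀)`
of a chain `σ` to the summand `F(c_{θ(0)})` of the chain `σ` pulled back along `θ`, by the action
on `F` of the morphism `c₀ ⟶ c_{θ(0)}`. -/
noncomputable def barSimplicialAction (F : C ⥤ ModuleCat.{u} k) {S T : SimplexCategory}
    (θ : S ⟶ T) : (⨁ σ : ComposableArrows C T.len, F.obj (σ.obj 0)) →ₗ[k]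
      ⨁ σ : ComposableArrows C S.len, F.obj (σ.obj 0) :=
  DirectSum.toModule k _ _ fun σ =>
    DirectSum.lof k (ComposableArrows C S.len) (fun τ => F.obj (τ.obj 0)) (chainPullback θ σ) ∘ₗ
      (F.map (chainStep θ σ)).hom

open Classical in
theorem barSimplicialAction_lof (F : C ⥤ ModuleCat.{u} k) {S T : SimplexCategory}
    (θ : S ⟶ T) (σ : ComposableArrows C T.len) (x : F.obj (σ.obj 0)) :
    barSimplicialAction F θ
        (DirectSum.lof k _ (fun τ : ComposableArrows C T.len => F.obj (τ.obj 0)) σ x) =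
      DirectSum.lof k _ (fun τ : ComposableArrows C S.len => F.obj (τ.obj 0)) (chainPullback θ σ)
        ((F.map (chainStep θ σ)).hom x) := by
  rw [barSimplicialAction, DirectSum.toModule_lof]
  rfl

theorem barSimplicialAction_id (F : C ⥤ ModuleCat.{u} k) (S : SimplexCategory) :
    barSimplicialAction F (𝟙 S) = LinearMap.id := by
  classical
  refine DirectSum.linearMap_ext _ fun σ => LinearMap.ext fun x => ?_
  refine (barSimplicialAction_lof F _ σ x).trans ?_
  have h : F.map (chainStep (𝟙 S) σ) = 𝟙 (F.obj (σ.obj 0)) := by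
    rw [← F.map_id, ← σ.map_id]
    rfl
  exact congrArg (DirectSum.lof k _ (fun τ : ComposableArrows C S.len => F.obj (τ.obj 0)) σ)
    (congrArg (fun φ => φ.hom x) h)

theorem barSimplicialAction_comp (F : C ⥤ ModuleCat.{u} k) {R S T : SimplexCategory}
    (η : R ⟶ S) (θ : S ⟶ T) :
    barSimplicialAction F (η ≫ θ) = barSimplicialAction F η ∘ₗ barSimplicialAction F θ := by
  classical
  refine DirectSum.linearMap_ext _ fun σ => LinearMap.ext fun x => ?_
  rw [LinearMap.comp_apply, LinearMap.comp_apply, LinearMap.comp_apply, barSimplicialAction_lof,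
    barSimplicialAction_lof, barSimplicialAction_lof]
  have h : F.map (chainStep (η ≫ θ) σ) =
      F.map (chainStep θ σ) ≫ F.map (chainStep η (chainPullback θ σ)) := by
    rw [← F.map_comp]
    congr 1
    exact (congrArg σ.map (Subsingleton.elim _ _)).trans (σ.map_comp _ _)
  exact congrArg (DirectSum.lof k _ (fun τ : ComposableArrows C R.len => F.obj (τ.obj 0))
    (chainPullback (η ≫ θ) σ)) (congrArg (fun φ => φ.hom x) h)

/-- The simplicial `k`-module that in degree `p` is the direct sum of `F(c₀)` over all chains
`c₀ ⟶ c₁ ⟶ ⋯ ⟶ c_p` of composable morphisms `f₁, …, f_p` of `C`. The `0`-th face deletes `f₁` and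
acts by `F(f₁)`, the last face drops `f_p`, the other faces compose adjacent morphisms, and the
degeneracies insert identities. -/
noncomputable def barSimplicial (F : C ⥤ ModuleCat.{u} k) : SimplicialObject (ModuleCat.{u} k) where
  obj S := ModuleCat.of k (⨁ σ : ComposableArrows C S.unop.len, F.obj (σ.obj 0))
  map θ := ModuleCat.ofHom (barSimplicialAction F θ.unop)
  map_id S := ModuleCat.hom_ext (barSimplicialAction_id F S.unop)
  map_comp θ η := ModuleCat.hom_ext (barSimplicialAction_comp F η.unop θ.unop)

/-- The bar complex of `F`: the chain complex of the simplicial module `barSimplicial F`, with the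
alternating sum of the faces as differential. -/
noncomputable def barComplex (F : C ⥤ ModuleCat.{u} k) : ChainComplex (ModuleCat.{u} k) ℕ :=
  (AlgebraicTopology.alternatingFaceMapComplex (ModuleCat.{u} k)).obj (barSimplicial F)

variable {D : Type} [SmallCategory D]

open Classical in
/-- The linear map induced by a functor `Φ : C ⥤ D` and a natural transformation `α : F ⟶ Φ ⋙ G`:
it sends the summand `F(c₀)` of a chain in `C` to the summand `G(Φ(c₀))` of its image in `D`,
by `α`. -/
noncomputable def barMap {F : C ⥤ ModuleCat.{u} k} {G : D ⥤ ModuleCat.{u} k} (Φ : C ⥤ D)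
    (α : F ⟶ Φ ⋙ G) (n : ℕ) : (⨁ σ : ComposableArrows C n, F.obj (σ.obj 0)) →ₗ[k]
      ⨁ σ : ComposableArrows D n, G.obj (σ.obj 0) :=
  DirectSum.toModule k _ _ fun σ =>
    DirectSum.lof k (ComposableArrows D n) (fun τ => G.obj (τ.obj 0)) (σ ⋙ Φ) ∘ₗ
      (α.app (σ.obj 0)).hom

open Classical in
theorem barMap_lof {F : C ⥤ ModuleCat.{u} k} {G : D ⥤ ModuleCat.{u} k} (Φ : C ⥤ D)
    (α : F ⟶ Φ ⋙ G) {n : ℕ} (σ : ComposableArrows C n) (x : F.obj (σ.obj 0)) :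
    barMap Φ α n (DirectSum.lof k _ (fun τ : ComposableArrows C n => F.obj (τ.obj 0)) σ x) =
      DirectSum.lof k _ (fun τ : ComposableArrows D n => G.obj (τ.obj 0)) (σ ⋙ Φ)
        ((α.app (σ.obj 0)).hom x) := by
  rw [barMap, DirectSum.toModule_lof]
  rfl

/-- The map of simplicial modules induced by `Φ : C ⥤ D` and `α : F ⟶ Φ ⋙ G`. -/
noncomputable def barSimplicialMap {F : C ⥤ ModuleCat.{u} k} {G : D ⥤ ModuleCat.{u} k} (Φ : C ⥤ D)
    (α : F ⟶ Φ ⋙ G) : barSimplicial F ⟶ barSimplicial G where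
  app S := ModuleCat.ofHom (barMap Φ α S.unop.len)
  naturality S T θ := by
    classical
    refine ModuleCat.hom_ext (DirectSum.linearMap_ext _ fun σ => LinearMap.ext fun x => ?_)
    change barMap Φ α T.unop.len (barSimplicialAction F θ.unop
        (DirectSum.lof k _ (fun τ : ComposableArrows C S.unop.len => F.obj (τ.obj 0)) σ x)) =
      barSimplicialAction G θ.unop (barMap Φ α S.unop.len
        (DirectSum.lof k _ (fun τ : ComposableArrows C S.unop.len => F.obj (τ.obj 0)) σ x))
    rw [barSimplicialAction_lof, barMap_lof, barMap_lof]
    refine Eq.trans ?_ (barSimplicialAction_lof G θ.unop (σ ⋙ Φ) _).symm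
    exact congrArg (DirectSum.lof k _ (fun τ : ComposableArrows D T.unop.len => G.obj (τ.obj 0))
      (chainPullback θ.unop σ ⋙ Φ)) (congrArg (fun φ => φ.hom x)
        (α.naturality (chainStep θ.unop σ)))

/-- The map of bar complexes induced by `Φ : C ⥤ D` and `α : F ⟶ Φ ⋙ G`. -/
noncomputable def barComplexMap {F : C ⥤ ModuleCat.{u} k} {G : D ⥤ ModuleCat.{u} k} (Φ : C ⥤ D)
    (α : F ⟶ Φ ⋙ G) : barComplex F ⟶ barComplex G :=
  (AlgebraicTopology.alternatingFaceMapComplex (ModuleCat.{u} k)).map (barSimplicialMap Φ α)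

end Bar

/-! ## Tensor products of functors and `Tor` -/

section Tor

variable {k : Type u} [CommRing k] {C : Type} [SmallCategory C]

section

variable (F : Cᵒᵖ ⥤ ModuleCat.{u} k) (G : C ⥤ ModuleCat.{u} k)

open Classical in
/-- The relations `x·f ⊗ y = x ⊗ f·y` in `⨁ c, F(c) ⊗ G(c)`, for `f : c ⟶ d`, `x ∈ F(d)`,
`y ∈ G(c)`. -/
noncomputable def tensorRelations :
    Submodule k (⨁ c : C, (F.obj (op c) : Type u) ⊗[k] (G.obj c : Type u)) :=
  Submodule.span k {z | ∃ (c d : C) (f : c ⟶ d) (x : F.obj (op d)) (y : G.obj c),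
    z = DirectSum.lof k C (fun c => (F.obj (op c) : Type u) ⊗[k] (G.obj c : Type u)) c
          ((F.map f.op).hom x ⊗ₜ[k] y) -
        DirectSum.lof k C (fun c => (F.obj (op c) : Type u) ⊗[k] (G.obj c : Type u)) d
          (x ⊗ₜ[k] (G.map f).hom y)}

end

open Classical in
/-- The map `⨁ c, F(c) ⊗ G(c) → ⨁ c, F'(c) ⊗ G(c)` induced by `α : F ⟶ F'`. -/
noncomputable def tensorMapAux {F F' : Cᵒᵖ ⥤ ModuleCat.{u} k} (α : F ⟶ F')
    (G : C ⥤ ModuleCat.{u} k) :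
    (⨁ c : C, (F.obj (op c) : Type u) ⊗[k] (G.obj c : Type u)) →ₗ[k]
      ⨁ c : C, (F'.obj (op c) : Type u) ⊗[k] (G.obj c : Type u) :=
  DirectSum.lmap fun c => (α.app (op c)).hom.rTensor (G.obj c : Type u)

open Classical in
theorem tensorMapAux_lof {F F' : Cᵒᵖ ⥤ ModuleCat.{u} k} (α : F ⟶ F')
    (G : C ⥤ ModuleCat.{u} k) (c : C) (x : F.obj (op c)) (y : G.obj c) :
    tensorMapAux α G (DirectSum.lof k C
        (fun c => (F.obj (op c) : Type u) ⊗[k] (G.obj c : Type u)) c (x ⊗ₜ[k] y)) =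
      DirectSum.lof k C (fun c => (F'.obj (op c) : Type u) ⊗[k] (G.obj c : Type u)) c
        ((α.app (op c)).hom x ⊗ₜ[k] y) := by
  rw [tensorMapAux, DirectSum.lmap_lof]
  rfl

theorem tensorRelations_le {F F' : Cᵒᵖ ⥤ ModuleCat.{u} k} (α : F ⟶ F')
    (G : C ⥤ ModuleCat.{u} k) :
    tensorRelations F G ≤ (tensorRelations F' G).comap (tensorMapAux α G) := by
  classical
  refine Submodule.span_le.2 ?_
  rintro _ ⟨c, d, f, x, y, rfl⟩
  refine Submodule.subset_span ⟨c, d, f, (α.app (op d)).hom x, y, ?_⟩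
  rw [map_sub, tensorMapAux_lof, tensorMapAux_lof]
  congr 3
  exact congrArg (fun φ => φ.hom x) (α.naturality f.op)

theorem tensorMapAux_id (F : Cᵒᵖ ⥤ ModuleCat.{u} k) (G : C ⥤ ModuleCat.{u} k) :
    tensorMapAux (𝟙 F) G = LinearMap.id := by
  classical
  refine DirectSum.linearMap_ext _ fun c => TensorProduct.ext' fun x y => ?_
  exact tensorMapAux_lof (𝟙 F) G c x y

theorem tensorMapAux_comp {F F' F'' : Cᵒᵖ ⥤ ModuleCat.{u} k} (α : F ⟶ F') (β : F' ⟶ F'')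
    (G : C ⥤ ModuleCat.{u} k) :
    tensorMapAux (α ≫ β) G = tensorMapAux β G ∘ₗ tensorMapAux α G := by
  classical
  refine DirectSum.linearMap_ext _ fun c => TensorProduct.ext' fun x y => ?_
  rw [LinearMap.comp_apply, LinearMap.comp_apply, LinearMap.comp_apply, tensorMapAux_lof,
    tensorMapAux_lof, tensorMapAux_lof]
  rfl

theorem tensorMapAux_add {F F' : Cᵒᵖ ⥤ ModuleCat.{u} k} (α β : F ⟶ F')
    (G : C ⥤ ModuleCat.{u} k) :
    tensorMapAux (α + β) G = tensorMapAux α G + tensorMapAux β G := by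
  classical
  refine DirectSum.linearMap_ext _ fun c => TensorProduct.ext' fun x y => ?_
  rw [LinearMap.comp_apply, LinearMap.comp_apply, LinearMap.add_apply, tensorMapAux_lof,
    tensorMapAux_lof, tensorMapAux_lof, ← map_add, ← TensorProduct.add_tmul]
  rfl

/-- The functor `F ↦ F ⊗_C G` on contravariant functors, where `F ⊗_C G` is the quotient of
`⨁ c, F(c) ⊗ G(c)` by the relations `x·f ⊗ y = x ⊗ f·y`, that is, the tensor product of the right
`k[C]`-module `⨁ c, F(c)` and the left `k[C]`-module `⨁ c, G(c)`. -/
noncomputable def tensorFunctor (G : C ⥤ ModuleCat.{u} k) :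
    (Cᵒᵖ ⥤ ModuleCat.{u} k) ⥤ ModuleCat.{u} k where
  obj F := ModuleCat.of k
    ((⨁ c : C, (F.obj (op c) : Type u) ⊗[k] (G.obj c : Type u)) ⧸ tensorRelations F G)
  map {F F'} α := ModuleCat.ofHom <|
    (tensorRelations F G).mapQ (tensorRelations F' G) (tensorMapAux α G) (tensorRelations_le α G)
  map_id F := by
    refine ModuleCat.hom_ext (Submodule.linearMap_qext _ (LinearMap.ext fun z => ?_))
    exact congrArg (Submodule.Quotient.mk (p := tensorRelations F G))
      (LinearMap.congr_fun (tensorMapAux_id F G) z)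
  map_comp {F F' F''} α β := by
    refine ModuleCat.hom_ext (Submodule.linearMap_qext _ (LinearMap.ext fun z => ?_))
    exact congrArg (Submodule.Quotient.mk (p := tensorRelations F'' G))
      (LinearMap.congr_fun (tensorMapAux_comp α β G) z)

instance (G : C ⥤ ModuleCat.{u} k) : (tensorFunctor G).Additive where
  map_add {F F' α β} := by
    refine ModuleCat.hom_ext (Submodule.linearMap_qext _ (LinearMap.ext fun z => ?_))
    exact congrArg (Submodule.Quotient.mk (p := tensorRelations F' G))
      (LinearMap.congr_fun (tensorMapAux_add α β G) z)

theorem projective_freeYoneda (c : C) (M : ModuleCat.{u} k) [Projective M] :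
    Projective (Presheaf.freeYoneda c M) where
  factors {E X} f e _ := by
    refine ⟨Presheaf.freeYonedaHomEquiv.symm
      (Projective.factorThru (Presheaf.freeYonedaHomEquiv f) (e.app (op c))), ?_⟩
    rw [Presheaf.freeYonedaHomEquiv_symm_comp, Projective.factorThru_comp,
      Equiv.symm_apply_apply]

/-- There are enough projectives: sums of free modules on representable functors. -/
instance : EnoughProjectives (Cᵒᵖ ⥤ ModuleCat.{u} k) where
  presentation F := by
    let P : C → (Cᵒᵖ ⥤ ModuleCat.{u} k) := fun c =>
      Presheaf.freeYoneda c (Projective.over (F.obj (op c)))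
    have hP : Projective (∐ P) :=
      { factors := fun {E X} f e _ => by
          have h : ∀ c, ∃ g : P c ⟶ E, g ≫ e = Limits.Sigma.ι P c ≫ f := fun c =>
            (projective_freeYoneda c (Projective.over (F.obj (op c)))).factors _ _
          choose g hg using h
          exact ⟨Limits.Sigma.desc g, Limits.Sigma.hom_ext _ _ fun c => by simp [hg]⟩ }
    let π : (∐ P) ⟶ F :=
      Limits.Sigma.desc fun c => Presheaf.freeYonedaHomEquiv.symm (Projective.π (F.obj (op c)))
    have hπ : ∀ X : Cᵒᵖ, Epi (π.app X) := by
      intro X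
      have h : Presheaf.freeYonedaHomEquiv (Limits.Sigma.ι P X.unop) ≫ π.app X =
          Projective.π (F.obj X) := by
        refine (Presheaf.freeYonedaHomEquiv_comp (Limits.Sigma.ι P X.unop) π).symm.trans ?_
        rw [Limits.Sigma.ι_desc, Equiv.apply_symm_apply]
      exact epi_of_epi_fac h
    exact ⟨{ p := ∐ P, f := π, epi := NatTrans.epi_of_epi_app π }⟩

/-- `Tor^C_n(F, G)`, the `n`-th left derived functor of `- ⊗_C G` at `F`. -/
noncomputable def functorTor (F : Cᵒᵖ ⥤ ModuleCat.{u} k) (G : C ⥤ ModuleCat.{u} k) (n : ℕ) :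
    ModuleCat.{u} k :=
  ((tensorFunctor G).leftDerived n).obj F

end Tor

/-! ## Symmetric homology and the complexes `L_*(A)`, `L^epi_*(A)` -/

section Main

variable (k A : Type u) [CommRing k] [Ring A] [Algebra k A]

/-- Symmetric homology `HS_n(A) = Tor^{ΔS}_n(k, B^sym A)`, where `k` is the trivial contravariant
functor, with value `k` on objects and the identity on morphisms. -/
noncomputable def HS (n : ℕ) : ModuleCat.{u} k :=
  functorTor ((Functor.const DeltaSᵒᵖ).obj (ModuleCat.of k k)) (Bsym k A) n

/-- The complex `L_*(A)`, with `L_p(A)` the direct sum of `A^{⊗ m₀+1}` over all chains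
`[m₀] ⟶ [m₁] ⟶ ⋯ ⟶ [m_p]` in `ΔS`. -/
noncomputable def L : ChainComplex (ModuleCat.{u} k) ℕ := barComplex (Bsym k A)

variable {k A} (ε : A →ₐ[k] k)

/-- The complex `L^epi_*(A)`, with `L^epi_p(A)` the direct sum of `B^sym_{m₀} I` over all chains
`[m₀] ↠ [m₁] ↠ ⋯ ↠ [m_p]` of epimorphisms in `ΔS`. -/
noncomputable def Lepi : ChainComplex (ModuleCat.{u} k) ℕ := barComplex (BsymI ε)

/-- The inclusion of `L^epi_*(A)` into `L_*(A)`. -/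
noncomputable def LepiInclusion : Lepi ε ⟶ L k A :=
  barComplexMap (wideSubcategoryInclusion (MorphismProperty.epimorphisms DeltaS)) (bsymInclusion ε)

end Main

end SymmetricHomology

/-!
For a set `S` of elements of `[m]` let `I^{⊗ S} ⊆ A^{⊗ m+1}` be spanned by the tensors with factors
in `I` at the places in `S` and factors `1` at the other places. The splitting `A = k ⊕ I` gives
`A^{⊗ m+1} = ⨁_S I^{⊗ S}`, and a morphism `f` of `ΔS` takes `I^{⊗ S}` to `I^{⊗ f(S)}`. Hence
`L_*(A)` is the bar complex of the functor `([m], S) ↦ I^{⊗ S}` on the category `MarkedDeltaS` of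
objects of `ΔS` with marked elements (`markedBarMap_bijective`). A morphism whose target has all
elements marked is an epimorphism, as is every morphism to `[0]`; so `L^epi_*(A)` is the bar complex
of the same functor on the full subcategory of the objects `([m], S)` with `S` everything or `m = 0`
(`reducedBarMap_bijective`). These objects are called reduced.

It remains to compare the two bar complexes over marked objects. Unmarked places carry the factor
`1`, so they can be discarded without changing `I^{⊗ S}`: this is the functor `reduce`. The only
object that does not survive is `S = ∅`, which would go to the empty set; it is sent to `[0]`
instead. There is no natural transformation from `reduce` to the identity, since `[0]` does not map
naturally to `[m]`, but both functors map naturally to `[m] ↦ [0] ⊔ [m]`, by `reduceToShiftNat` and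
`toShift`. Natural transformations induce chain homotopies of bar complexes (`barComplexHomotopy`),
and injective morphisms act on the modules by isomorphisms (`isIso_markedBsym_map`), so this zigzag
makes the inclusion of the reduced objects a homotopy equivalence (`reducedBarHomotopyEquiv`).

For `Tor`, the free modules on the nerves of the coslice categories `c / ΔS` form a resolution of
the trivial functor: the nerves are contractible because `𝟙 c` is initial
(`cosliceNerveExtraDegeneracy`), and in each degree the modules form a sum of free functors on
representable ones (`projective_barResolution`). By the Yoneda lemma, the tensor product of this
resolution with `B^sym A` is `L_*(A)` (`tensorBarResolutionIso`).
-/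

namespace SymmetricHomology

/-! ### Functoriality of the bar complex -/

section BarFunctoriality

variable {k : Type u} [CommRing k] {C D E : Type} [SmallCategory C] [SmallCategory D]
  [SmallCategory E]

open Classical in
theorem lof_congr {F : C ⥤ ModuleCat.{u} k} {n : ℕ} {σ τ : ComposableArrows C n} (h : σ = τ)
    {x : F.obj (σ.obj 0)} {y : F.obj (τ.obj 0)} (hxy : x ≍ y) :
    DirectSum.lof k _ (fun τ : ComposableArrows C n => F.obj (τ.obj 0)) σ x =
      DirectSum.lof k _ (fun τ : ComposableArrows C n => F.obj (τ.obj 0)) τ y := by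
  subst h
  rw [eq_of_heq hxy]

theorem barMap_id (F : C ⥤ ModuleCat.{u} k) (n : ℕ) :
    barMap (𝟭 C) F.leftUnitor.inv n = LinearMap.id := by
  classical
  exact DirectSum.linearMap_ext _ fun σ => LinearMap.ext fun x => barMap_lof _ _ σ x

theorem barMap_comp {F : C ⥤ ModuleCat.{u} k} {G : D ⥤ ModuleCat.{u} k}
    {H : E ⥤ ModuleCat.{u} k} (Φ : C ⥤ D) (α : F ⟶ Φ ⋙ G) (Ψ : D ⥤ E) (β : G ⟶ Ψ ⋙ H)
    (γ : F ⟶ (Φ ⋙ Ψ) ⋙ H) (h : ∀ c, γ.app c = α.app c ≫ β.app (Φ.obj c)) (n : ℕ) :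
    barMap (Φ ⋙ Ψ) γ n = barMap Ψ β n ∘ₗ barMap Φ α n := by
  classical
  refine DirectSum.linearMap_ext _ fun σ => LinearMap.ext fun x => ?_
  refine (barMap_lof _ _ σ x).trans ?_
  refine Eq.trans ?_ (congrArg (barMap Ψ β n) (barMap_lof Φ α σ x)).symm
  refine Eq.trans ?_ (barMap_lof Ψ β (σ ⋙ Φ) _).symm
  rw [h]
  rfl

theorem barComplexMap_id (F : C ⥤ ModuleCat.{u} k) :
    barComplexMap (𝟭 C) F.leftUnitor.inv = 𝟙 (barComplex F) := by
  ext1 n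
  exact congrArg ModuleCat.ofHom (barMap_id F n)

theorem barComplexMap_comp {F : C ⥤ ModuleCat.{u} k} {G : D ⥤ ModuleCat.{u} k}
    {H : E ⥤ ModuleCat.{u} k} (Φ : C ⥤ D) (α : F ⟶ Φ ⋙ G) (Ψ : D ⥤ E) (β : G ⟶ Ψ ⋙ H)
    (γ : F ⟶ (Φ ⋙ Ψ) ⋙ H) (h : ∀ c, γ.app c = α.app c ≫ β.app (Φ.obj c)) :
    barComplexMap Φ α ≫ barComplexMap Ψ β = barComplexMap (Φ ⋙ Ψ) γ := by
  ext1 n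
  exact (congrArg ModuleCat.ofHom (barMap_comp Φ α Ψ β γ h n)).symm

theorem isIso_barComplexMap {F : C ⥤ ModuleCat.{u} k} {G : D ⥤ ModuleCat.{u} k} (Φ : C ⥤ D)
    (α : F ⟶ Φ ⋙ G) (h : ∀ n, Function.Bijective (barMap Φ α n)) :
    IsIso (barComplexMap Φ α) := by
  have : ∀ n, IsIso ((barComplexMap Φ α).f n) := fun n => by
    rw [ConcreteCategory.isIso_iff_bijective]
    exact h n
  exact HomologicalComplex.Hom.isIso_of_components _

/-- The map of bar constructions is injective if `Φ` is injective on chains and the coefficient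
maps are injective. -/
theorem barMap_injective {F : C ⥤ ModuleCat.{u} k} {G : D ⥤ ModuleCat.{u} k} (Φ : C ⥤ D)
    (α : F ⟶ Φ ⋙ G) {n : ℕ}
    (hΦ : Function.Injective fun σ : ComposableArrows C n => (σ ⋙ Φ : ComposableArrows D n))
    (hα : ∀ c, Function.Injective (α.app c).hom) : Function.Injective (barMap Φ α n) := by
  classical
  have key : ∀ z σ, (barMap Φ α n z) (σ ⋙ Φ) = (α.app (σ.obj 0)).hom (z σ) := by
    intro z σ
    induction z using DirectSum.induction_on with
    | zero => simp
    | add x y hx hy =>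
      rw [map_add, DirectSum.add_apply, hx, hy, DirectSum.add_apply, map_add]
    | of τ x =>
      change (barMap Φ α n (DirectSum.lof k _
        (fun τ : ComposableArrows C n => F.obj (τ.obj 0)) τ x)) (σ ⋙ Φ) = _
      rw [barMap_lof]
      by_cases h : τ = σ
      · subst h
        rw [DirectSum.lof_apply]
        erw [DirectSum.of_eq_same]
      · erw [DirectSum.of_eq_of_ne _ _ _ (Ne.symm h), DirectSum.of_eq_of_ne, map_zero]
        exact fun h' => h (hΦ h'.symm)
  rw [injective_iff_map_eq_zero]
  intro z hz
  refine DFinsupp.ext fun σ => hα _ ?_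
  rw [← key, hz]
  simp

end BarFunctoriality

/-! ### Natural transformations and chain homotopies -/

section BarHomotopy

variable {k : Type u} [CommRing k] {C D : Type} [SmallCategory C] [SmallCategory D]
  {F : C ⥤ ModuleCat.{u} k} {G : D ⥤ ModuleCat.{u} k} {Φ Ψ : C ⥤ D}

section Coefficients

variable {M N : ModuleCat.{u} k} {a b c : D}

theorem map_hom_comp_map_apply (α : M ⟶ G.obj a) (f : a ⟶ b) (g : b ⟶ c) (h : a ⟶ c)
    (w : f ≫ g = h) (x : M) :
    (G.map g).hom ((α ≫ G.map f).hom x) = (α ≫ G.map h).hom x := by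
  simp [← w]

theorem comp_map_hom_apply_of_comm (ρ : M ⟶ N) (α : M ⟶ G.obj a) (β : N ⟶ G.obj b) (f : a ⟶ b)
    (w : ρ ≫ β = α ≫ G.map f) (g : b ⟶ c) (h : a ⟶ c) (w' : f ≫ g = h) (x : M) :
    (β ≫ G.map g).hom (ρ.hom x) = (α ≫ G.map h).hom x := by
  rw [← w', G.map_comp, ← Category.assoc, ← w, Category.assoc]
  rfl

theorem comp_map_hom_apply_of_eq_id (α : M ⟶ G.obj a) (f : a ⟶ a) (w : f = 𝟙 a) (x : M) :
    (α ≫ G.map f).hom x = α.hom x := by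
  simp [w]

end Coefficients

/-- The product partial order `{0, …, n} × {0, 1}`, regarded as a category through its order. It is
not reducible to a product type, whose category structure would be that of a product category. -/
def Prism (n : ℕ) : Type := Fin (n + 1) × Fin 2

instance (n : ℕ) : PartialOrder (Prism n) := inferInstanceAs (PartialOrder (Fin (n + 1) × Fin 2))

/-- The functor `{0, …, n} × {0, 1} ⥤ D` given by a chain of `n` morphisms of `C` and a natural
transformation of functors `C ⥤ D`. -/
abbrev prism (η : Φ ⟶ Ψ) {n : ℕ} (σ : ComposableArrows C n) : Prism n ⥤ D :=
  ((Monotone.functor (X := Prism n) (f := Prod.fst) monotone_fst) ⋙ σ).prod'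
    ((Monotone.functor (X := Prism n) (f := Prod.snd) monotone_snd) ⋙ ComposableArrows.mk₁ η) ⋙
      evaluationUncurried C D

/-- The chain in `D` obtained by pulling back the prism on a chain in `C` along a monotone map. -/
abbrev prismPullback (η : Φ ⟶ Ψ) {m n : ℕ} (u : Fin (m + 1) →o Prism n)
    (σ : ComposableArrows C n) : ComposableArrows D m :=
  u.monotone.functor ⋙ prism η σ

/-- The morphism from the initial vertex of a prism to another one. -/
def prismEdge (η : Φ ⟶ Ψ) {n : ℕ} (σ : ComposableArrows C n) (p : Prism n) :
    Φ.obj (σ.obj 0) ⟶ (prism η σ).obj p :=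
  (prism η σ).map (X := ((0, 0) : Fin (n + 1) × Fin 2))
    (homOfLE (⟨Fin.zero_le _, Fin.zero_le _⟩ : ((0, 0) : Fin (n + 1) × Fin 2) ≤ p))

theorem prismEdge_comp (η : Φ ⟶ Ψ) {n : ℕ} (σ : ComposableArrows C n) {p q : Prism n}
    (f : p ⟶ q) : prismEdge η σ p ≫ (prism η σ).map f = prismEdge η σ q :=
  ((prism η σ).map_comp _ _).symm

open Classical in
/-- The map of bar constructions that sends the summand of a chain `σ` to the summand of the
pullback of the prism on `σ` along `u`. The choices of `u` give the maps induced by both functors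
and the simplicial homotopy between them. -/
noncomputable def prismMap (α : F ⟶ Φ ⋙ G) (η : Φ ⟶ Ψ) {m n : ℕ}
    (u : Fin (m + 1) →o Prism n) :
    (⨁ σ : ComposableArrows C n, F.obj (σ.obj 0)) →ₗ[k]
      ⨁ σ : ComposableArrows D m, G.obj (σ.obj 0) :=
  DirectSum.toModule k _ _ fun σ =>
    DirectSum.lof k (ComposableArrows D m) (fun τ => G.obj (τ.obj 0)) (prismPullback η u σ) ∘ₗ
      (α.app (σ.obj 0) ≫ G.map (prismEdge η σ (u 0))).hom

open Classical in
theorem prismMap_lof (α : F ⟶ Φ ⋙ G) (η : Φ ⟶ Ψ) {m n : ℕ}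
    (u : Fin (m + 1) →o Prism n) (σ : ComposableArrows C n) (x : F.obj (σ.obj 0)) :
    prismMap α η u (DirectSum.lof k _ (fun τ : ComposableArrows C n => F.obj (τ.obj 0)) σ x) =
      DirectSum.lof k (ComposableArrows D m) (fun τ => G.obj (τ.obj 0)) (prismPullback η u σ)
        ((α.app (σ.obj 0) ≫ G.map (prismEdge η σ (u 0))).hom x) := by
  rw [prismMap, DirectSum.toModule_lof]
  rfl

/-- The product of a map of simplices with the identity of `{0, 1}`. -/
def prodIdHom {S T : SimplexCategory} (θ : S ⟶ T) : Prism S.len →o Prism T.len :=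
  ⟨fun x => (θ.toOrderHom x.1, x.2), fun _ _ h => ⟨θ.toOrderHom.monotone h.1, h.2⟩⟩

theorem barSimplicialAction_comp_prismMap (α : F ⟶ Φ ⋙ G) (η : Φ ⟶ Ψ) {n : ℕ}
    {S T : SimplexCategory} (θ : S ⟶ T) (u : Fin (T.len + 1) →o Prism n) :
    barSimplicialAction G θ ∘ₗ prismMap α η u = prismMap α η (u.comp θ.toOrderHom) := by
  classical
  refine DirectSum.linearMap_ext _ fun σ => LinearMap.ext fun x => ?_
  refine (congrArg (barSimplicialAction G θ) (prismMap_lof α η u σ x)).trans ?_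
  refine (barSimplicialAction_lof G θ (prismPullback η u σ) _).trans ?_
  refine Eq.trans ?_ (prismMap_lof α η (u.comp θ.toOrderHom) σ x).symm
  refine lof_congr rfl (heq_of_eq ?_)
  exact map_hom_comp_map_apply _ (prismEdge η σ (u 0)) _ _ (prismEdge_comp η σ _) x

theorem prismMap_comp_barSimplicialAction (α : F ⟶ Φ ⋙ G) (η : Φ ⟶ Ψ) {m : ℕ}
    {S T : SimplexCategory} (θ : S ⟶ T) (u : Fin (m + 1) →o Prism S.len) :
    prismMap α η u ∘ₗ barSimplicialAction F θ = prismMap α η ((prodIdHom θ).comp u) := by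
  classical
  refine DirectSum.linearMap_ext _ fun σ => LinearMap.ext fun x => ?_
  refine (congrArg (prismMap α η u) (barSimplicialAction_lof F θ σ x)).trans ?_
  refine (prismMap_lof α η u (chainPullback θ σ) _).trans ?_
  refine Eq.trans ?_ (prismMap_lof α η ((prodIdHom θ).comp u) σ x).symm
  refine lof_congr rfl (heq_of_eq ?_)
  have h : Φ.map (chainStep θ σ) = prismEdge η σ (θ.toOrderHom 0, 0) := by
    change _ = Φ.map _ ≫ 𝟙 _
    rw [Category.comp_id]
    rfl
  refine comp_map_hom_apply_of_comm (G := G) (F.map (chainStep θ σ))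
    (a := Φ.obj (σ.obj 0)) (b := Φ.obj ((chainPullback θ σ).obj 0)) (α.app (σ.obj 0))
    (α.app ((chainPullback θ σ).obj 0)) (Φ.map (chainStep θ σ)) (α.naturality _)
    (prismEdge η (chainPullback θ σ) (u 0)) _ ?_ x
  rw [h]
  exact prismEdge_comp η σ (p := (θ.toOrderHom 0, 0)) (q := prodIdHom θ (u 0))
    (homOfLE ((prodIdHom θ).monotone (a := ((0, 0) : Fin (S.len + 1) × Fin 2))
      ⟨Fin.zero_le _, Fin.zero_le _⟩))

/-- The inclusion of `{0, …, n}` as an end of the prism. -/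
def prismEnd (n : ℕ) (e : Fin 2) : Fin (n + 1) →o Prism n :=
  ⟨fun i => (i, e), fun _ _ h => ⟨h, le_rfl⟩⟩

theorem prismMap_end_zero (α : F ⟶ Φ ⋙ G) (η : Φ ⟶ Ψ) (n : ℕ) :
    prismMap α η (prismEnd n 0) = barMap Φ α n := by
  classical
  refine DirectSum.linearMap_ext _ fun σ => LinearMap.ext fun x => ?_
  refine (prismMap_lof α η (prismEnd n 0) σ x).trans
    (Eq.trans ?_ (barMap_lof Φ α σ x).symm)
  have hσ : prismPullback η (prismEnd n 0) σ = σ ⋙ Φ := by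
    refine CategoryTheory.Functor.hext (fun _ => rfl) fun i j f => heq_of_eq ?_
    change Φ.map _ ≫ 𝟙 _ = Φ.map _
    rw [Category.comp_id]
    rfl
  refine lof_congr hσ (heq_of_eq ?_)
  exact comp_map_hom_apply_of_eq_id _ _ ((prism η σ).map_id _) x

theorem prismMap_end_one (α : F ⟶ Φ ⋙ G) (η : Φ ⟶ Ψ) (β : F ⟶ Ψ ⋙ G)
    (hβ : ∀ c, β.app c = α.app c ≫ G.map (η.app c)) (n : ℕ) :
    prismMap α η (prismEnd n 1) = barMap Ψ β n := by
  classical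
  refine DirectSum.linearMap_ext _ fun σ => LinearMap.ext fun x => ?_
  refine (prismMap_lof α η (prismEnd n 1) σ x).trans
    (Eq.trans ?_ (barMap_lof Ψ β σ x).symm)
  have hσ : prismPullback η (prismEnd n 1) σ = σ ⋙ Ψ := by
    refine CategoryTheory.Functor.hext (fun _ => rfl) fun i j f => heq_of_eq ?_
    change Ψ.map _ ≫ 𝟙 _ = Ψ.map _
    rw [Category.comp_id]
    rfl
  refine lof_congr hσ (heq_of_eq ?_)
  have h : prismEdge η σ (prismEnd n 1 0) = η.app (σ.obj 0) := by
    change Φ.map (σ.map (𝟙 _)) ≫ η.app _ = _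
    rw [σ.map_id, Φ.map_id, Category.id_comp]
    rfl
  rw [h, hβ]
  rfl

/-- The `j`-th of the maximal simplices of the prism: it runs through `0, …, j` at the first end
and through `j, …, n` at the second. -/
def prismStep {n : ℕ} (j : Fin (n + 1)) : Fin (n + 2) →o Prism n :=
  ⟨fun i => (Fin.predAbove j i, if i ≤ j.castSucc then 0 else 1), fun a b h => by
    refine ⟨Fin.predAbove_right_monotone j h, ?_⟩
    dsimp only
    split_ifs with h1 h2 h2
    · exact le_rfl
    · exact Fin.zero_le _
    · exact absurd (h.trans h2) h1
    · exact le_rfl⟩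

theorem val_predAbove {n : ℕ} (p : Fin n) (i : Fin (n + 1)) :
    (p.predAbove i : ℕ) = if (p : ℕ) < i then (i : ℕ) - 1 else i := by
  rw [Fin.predAbove]
  split_ifs with h1 h2 h2 <;> simp only [Fin.lt_def, Fin.val_castSucc] at h1 <;> simp <;> omega

theorem val_succAbove {n : ℕ} (p : Fin (n + 1)) (i : Fin n) :
    (p.succAbove i : ℕ) = if (i : ℕ) < p then (i : ℕ) else i + 1 := by
  rw [Fin.succAbove]
  split_ifs with h1 h2 h2 <;> simp only [Fin.lt_def, Fin.val_castSucc] at h1 <;> simp <;> omega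

/-- A natural transformation `η : Φ ⟶ Ψ` induces a simplicial homotopy between the maps of bar
constructions induced by `Φ` and `Ψ`. -/
noncomputable def barSimplicialHomotopy (α : F ⟶ Φ ⋙ G) (η : Φ ⟶ Ψ) (β : F ⟶ Ψ ⋙ G)
    (hβ : ∀ c, β.app c = α.app c ≫ G.map (η.app c)) :
    SimplicialObject.Homotopy (barSimplicialMap Φ α) (barSimplicialMap Ψ β) where
  -- Each identity is reduced to an equality of monotone maps to the prism.
  h {n} j := ModuleCat.ofHom (prismMap α η (prismStep j))
  h_zero_comp_δ_zero n := by
    refine ModuleCat.hom_ext ((barSimplicialAction_comp_prismMap α η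
      (SimplexCategory.δ 0) (prismStep 0)).trans (Eq.trans ?_ (prismMap_end_one α η β hβ n)))
    congr 1
  h_last_comp_δ_last n := by
    refine ModuleCat.hom_ext ((barSimplicialAction_comp_prismMap α η
      (SimplexCategory.δ (Fin.last (n + 1))) (prismStep (Fin.last n))).trans
        (Eq.trans ?_ (prismMap_end_zero α η n)))
    congr 1
    refine OrderHom.ext _ _ (funext fun t => Prod.ext (Fin.ext ?_) ?_)
    · change (Fin.predAbove (Fin.last n) ((Fin.last (n + 1)).succAbove t) : ℕ) = (t : ℕ)
      simp only [val_predAbove, val_succAbove, Fin.val_last]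
      split_ifs <;> omega
    · change (if (Fin.last (n + 1)).succAbove t ≤ Fin.castSucc (Fin.last n) then (0 : Fin 2)
        else 1) = 0
      rw [if_pos]
      simp only [val_succAbove, Fin.le_def, Fin.val_castSucc, Fin.val_last]
      split_ifs <;> omega
  h_succ_comp_δ_castSucc_of_lt {n} i j hij := by
    refine ModuleCat.hom_ext ((barSimplicialAction_comp_prismMap α η
      (SimplexCategory.δ i.castSucc) (prismStep j.succ)).trans (Eq.trans ?_
      (prismMap_comp_barSimplicialAction α η (SimplexCategory.δ i) (prismStep j)).symm))
    congr 1
    rw [Fin.le_def, Fin.val_castSucc] at hij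
    refine OrderHom.ext _ _ (funext fun t => Prod.ext (Fin.ext ?_) ?_)
    · change (Fin.predAbove j.succ (i.castSucc.succAbove t) : ℕ) =
        (Fin.succAbove i (Fin.predAbove j t) : ℕ)
      simp only [val_predAbove, val_succAbove, Fin.val_succ, Fin.val_castSucc]
      split_ifs <;> omega
    · change (if i.castSucc.succAbove t ≤ Fin.castSucc j.succ then (0 : Fin 2) else 1) =
        if t ≤ Fin.castSucc j then (0 : Fin 2) else 1
      congr 1
      simp only [val_succAbove, Fin.le_def, Fin.val_succ, Fin.val_castSucc, eq_iff_iff]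
      split_ifs <;> omega
  h_succ_comp_δ_castSucc_succ {n} j := by
    refine ModuleCat.hom_ext ((barSimplicialAction_comp_prismMap α η
      (SimplexCategory.δ j.castSucc.succ) (prismStep j.succ)).trans (Eq.trans ?_
      (barSimplicialAction_comp_prismMap α η (SimplexCategory.δ j.castSucc.succ)
        (prismStep j.castSucc)).symm))
    congr 1
    refine OrderHom.ext _ _ (funext fun t => Prod.ext (Fin.ext ?_) ?_)
    · change (Fin.predAbove j.succ (j.castSucc.succ.succAbove t) : ℕ) =
        (Fin.predAbove j.castSucc (j.castSucc.succ.succAbove t) : ℕ)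
      simp only [val_predAbove, val_succAbove, Fin.val_succ, Fin.val_castSucc]
      split_ifs <;> omega
    · change (if j.castSucc.succ.succAbove t ≤ Fin.castSucc j.succ then (0 : Fin 2) else 1) =
        if j.castSucc.succ.succAbove t ≤ Fin.castSucc j.castSucc then (0 : Fin 2) else 1
      congr 1
      simp only [val_succAbove, Fin.le_def, Fin.val_succ, Fin.val_castSucc, eq_iff_iff]
      split_ifs <;> omega
  h_castSucc_comp_δ_succ_of_lt i j hji := by
    refine ModuleCat.hom_ext ((barSimplicialAction_comp_prismMap α η
      (SimplexCategory.δ i.succ) (prismStep j.castSucc)).trans (Eq.trans ?_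
      (prismMap_comp_barSimplicialAction α η (SimplexCategory.δ i) (prismStep j)).symm))
    congr 1
    rw [Fin.lt_def, Fin.val_castSucc] at hji
    refine OrderHom.ext _ _ (funext fun t => Prod.ext (Fin.ext ?_) ?_)
    · change (Fin.predAbove j.castSucc (i.succ.succAbove t) : ℕ) =
        (Fin.succAbove i (Fin.predAbove j t) : ℕ)
      simp only [val_predAbove, val_succAbove, Fin.val_succ, Fin.val_castSucc]
      split_ifs <;> omega
    · change (if i.succ.succAbove t ≤ Fin.castSucc j.castSucc then (0 : Fin 2) else 1) =
        if t ≤ Fin.castSucc j then (0 : Fin 2) else 1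
      congr 1
      simp only [val_succAbove, Fin.le_def, Fin.val_succ, Fin.val_castSucc, eq_iff_iff]
      split_ifs <;> omega
  h_comp_σ_castSucc_of_le i j hij := by
    refine ModuleCat.hom_ext ((barSimplicialAction_comp_prismMap α η
      (SimplexCategory.σ i.castSucc) (prismStep j)).trans (Eq.trans ?_
      (prismMap_comp_barSimplicialAction α η (SimplexCategory.σ i) (prismStep j.succ)).symm))
    congr 1
    rw [Fin.le_def] at hij
    refine OrderHom.ext _ _ (funext fun t => Prod.ext (Fin.ext ?_) ?_)
    · change (Fin.predAbove j (i.castSucc.predAbove t) : ℕ) =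
        (Fin.predAbove i (Fin.predAbove j.succ t) : ℕ)
      simp only [val_predAbove, Fin.val_succ, Fin.val_castSucc]
      split_ifs <;> omega
    · change (if i.castSucc.predAbove t ≤ Fin.castSucc j then (0 : Fin 2) else 1) =
        if t ≤ Fin.castSucc j.succ then (0 : Fin 2) else 1
      congr 1
      simp only [val_predAbove, Fin.le_def, Fin.val_succ, Fin.val_castSucc, eq_iff_iff]
      split_ifs <;> omega
  h_comp_σ_succ_of_lt i j hji := by
    refine ModuleCat.hom_ext ((barSimplicialAction_comp_prismMap α η
      (SimplexCategory.σ i.succ) (prismStep j)).trans (Eq.trans ?_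
      (prismMap_comp_barSimplicialAction α η (SimplexCategory.σ i) (prismStep j.castSucc)).symm))
    congr 1
    rw [Fin.le_def] at hji
    refine OrderHom.ext _ _ (funext fun t => Prod.ext (Fin.ext ?_) ?_)
    · change (Fin.predAbove j (i.succ.predAbove t) : ℕ) =
        (Fin.predAbove i (Fin.predAbove j.castSucc t) : ℕ)
      simp only [val_predAbove, Fin.val_succ, Fin.val_castSucc]
      split_ifs <;> omega
    · change (if i.succ.predAbove t ≤ Fin.castSucc j then (0 : Fin 2) else 1) =
        if t ≤ Fin.castSucc j.castSucc then (0 : Fin 2) else 1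
      congr 1
      simp only [val_predAbove, Fin.le_def, Fin.val_succ, Fin.val_castSucc, eq_iff_iff]
      split_ifs <;> omega

/-- A natural transformation `η : Φ ⟶ Ψ` induces a chain homotopy between the maps of bar complexes
induced by `Φ` and `Ψ`. -/
noncomputable def barComplexHomotopy (α : F ⟶ Φ ⋙ G) (η : Φ ⟶ Ψ) (β : F ⟶ Ψ ⋙ G)
    (hβ : ∀ c, β.app c = α.app c ≫ G.map (η.app c)) :
    Homotopy (barComplexMap Φ α) (barComplexMap Ψ β) :=
  (barSimplicialHomotopy α η β hβ).toChainHomotopy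

/-- A natural transformation from the identity functor to `T` induces a chain homotopy from the
identity to the map of bar complexes induced by `T`. -/
noncomputable def barComplexHomotopyOfId {T : C ⥤ C} (η : 𝟭 C ⟶ T) (β : F ⟶ T ⋙ F)
    (hβ : ∀ c, β.app c = F.map (η.app c)) : Homotopy (𝟙 (barComplex F)) (barComplexMap T β) :=
  (Homotopy.ofEq (barComplexMap_id F).symm).trans
    (barComplexHomotopy F.leftUnitor.inv η β fun c => by
      rw [hβ, Functor.leftUnitor_inv_app, Category.id_comp])

end BarHomotopy

/-! ### Decomposition of tensor powers of an augmented algebra -/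

section MarkedTensors

variable {k A : Type u} [CommRing k] [Ring A] [Algebra k A] (ε : A →ₐ[k] k)
  {ι : Type}

/-- The submodule `I^{⊗ S}` of `A^{⊗ ι}`: it is spanned by the tensors with factors in the
augmentation ideal `I` at the places in `S` and with factors `1` at the other places. -/
def markedTensors (S : Finset ι) : Submodule k (⨂[k] _ : ι, A) :=
  Submodule.span k {z | ∃ a : ι → A, (∀ j ∈ S, a j ∈ augIdeal ε) ∧ (∀ j ∉ S, a j = 1) ∧
    z = PiTensorProduct.tprod k a}

variable {ε} in
theorem tprod_mem_markedTensors {S : Finset ι} {a : ι → A} (h : ∀ j ∈ S, a j ∈ augIdeal ε)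
    (h' : ∀ j ∉ S, a j = 1) : PiTensorProduct.tprod k a ∈ markedTensors ε S :=
  Submodule.subset_span ⟨a, h, h', rfl⟩

/-- The projection `a ↦ ε(a)·1` of `A` onto the line spanned by `1`. -/
def augProj : A →ₗ[k] A := Algebra.linearMap k A ∘ₗ ε.toLinearMap

theorem augProj_apply (a : A) : augProj ε a = ε a • (1 : A) := Algebra.algebraMap_eq_smul_one _

theorem augProj_one : augProj ε (1 : A) = 1 := by simp [augProj_apply]

variable {ε} in
theorem augProj_of_mem {a : A} (h : a ∈ augIdeal ε) : augProj ε a = 0 := by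
  have h' : ε a = 0 := h
  rw [augProj_apply, h', zero_smul]

theorem sub_augProj_mem (a : A) : a - augProj ε a ∈ augIdeal ε := by
  change ε (a - augProj ε a) = 0
  rw [augProj_apply, map_sub, map_smul, map_one, smul_eq_mul, mul_one, sub_self]

variable [DecidableEq ι]

/-- The projection of `A^{⊗ ι}` onto `I^{⊗ S}` that is the tensor product of the projections
of `A` onto `I` at the places in `S` and onto the line spanned by `1` at the others. -/
noncomputable def markedProj (S : Finset ι) : (⨂[k] _ : ι, A) →ₗ[k] ⨂[k] _ : ι, A :=
  PiTensorProduct.map fun j => if j ∈ S then LinearMap.id - augProj ε else augProj ε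

theorem markedProj_tprod (S : Finset ι) (a : ι → A) :
    markedProj ε S (PiTensorProduct.tprod k a) =
      PiTensorProduct.tprod k fun j =>
        if j ∈ S then a j - augProj ε (a j) else augProj ε (a j) := by
  rw [markedProj, PiTensorProduct.map_tprod]
  congr 1
  funext j
  split_ifs <;> rfl

theorem markedProj_mem [Fintype ι] (S : Finset ι) (z : ⨂[k] _ : ι, A) :
    markedProj ε S z ∈ markedTensors ε S := by
  induction z using PiTensorProduct.induction_on with
  | add x y hx hy => rw [map_add]; exact add_mem hx hy
  | smul_tprod r a =>
    rw [map_smul, markedProj_tprod]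
    refine Submodule.smul_mem _ _ ?_
    have h : (fun j => if j ∈ S then a j - augProj ε (a j) else augProj ε (a j)) =
        fun j => (if j ∈ S then (1 : k) else ε (a j)) •
          (if j ∈ S then a j - augProj ε (a j) else 1) := by
      funext j
      split_ifs
      · rw [one_smul]
      · rw [augProj_apply]
    rw [h, MultilinearMap.map_smul_univ]
    refine Submodule.smul_mem _ _ (tprod_mem_markedTensors (fun j hj => ?_) fun j hj => ?_)
    · rw [if_pos hj]; exact sub_augProj_mem ε _
    · rw [if_neg hj]

theorem sum_markedProj [Fintype ι] (z : ⨂[k] _ : ι, A) : ∑ S : Finset ι, markedProj ε S z = z := by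
  induction z using PiTensorProduct.induction_on with
  | add x y hx hy => simp_rw [map_add, Finset.sum_add_distrib, hx, hy]
  | smul_tprod r a =>
    simp_rw [map_smul, ← Finset.smul_sum, markedProj_tprod]
    congr 1
    have h := (PiTensorProduct.tprod k).map_add_univ (fun j => a j - augProj ε (a j))
      (fun j => augProj ε (a j))
    have h' : ((fun j => a j - augProj ε (a j)) + fun j => augProj ε (a j)) = a := by
      funext j; simp
    rw [h'] at h
    rw [h]
    rfl

variable {ε} in
theorem markedProj_of_mem {S : Finset ι} {z : ⨂[k] _ : ι, A} (hz : z ∈ markedTensors ε S) :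
    markedProj ε S z = z := by
  refine LinearMap.eqOn_span' (f := markedProj ε S) (g := LinearMap.id) ?_ hz
  rintro _ ⟨a, h1, h2, rfl⟩
  rw [markedProj_tprod, LinearMap.id_apply]
  congr 1
  funext j
  split_ifs with hj
  · rw [augProj_of_mem (h1 j hj), sub_zero]
  · rw [h2 j hj, augProj_one]

variable {ε} in
theorem markedProj_of_mem_of_ne {S T : Finset ι} (hST : S ≠ T) {z : ⨂[k] _ : ι, A}
    (hz : z ∈ markedTensors ε S) : markedProj ε T z = 0 := by
  refine LinearMap.eqOn_span' (f := markedProj ε T) (g := 0) ?_ hz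
  rintro _ ⟨a, h1, h2, rfl⟩
  rw [markedProj_tprod, LinearMap.zero_apply]
  obtain ⟨j, hj⟩ : ∃ j, ¬ (j ∈ S ↔ j ∈ T) := by
    by_contra! h
    exact hST (Finset.ext h)
  refine MultilinearMap.map_coord_zero _ j ?_
  by_cases hT : j ∈ T
  · rw [if_pos hT, h2 j fun h => hj (iff_of_true h hT), augProj_one, sub_self]
  · rw [if_neg hT, augProj_of_mem (h1 j (by tauto))]

end MarkedTensors

/-! ### Marked objects of `ΔS` and their bar complex -/

/-- An object `[m]` of `ΔS` together with a set of marked elements. -/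
@[ext]
structure MarkedDeltaS : Type where
  /-- The underlying object. -/
  obj : DeltaS
  /-- The marked elements. -/
  marked : Finset (Fin (obj.len + 1))

namespace MarkedDeltaS

/-- A morphism of marked objects is a morphism of `ΔS` that maps the marked elements of the source
onto those of the target. -/
instance : SmallCategory MarkedDeltaS where
  Hom X Y := {f : X.obj ⟶ Y.obj // X.marked.image (DeltaS.Hom.toFun f) = Y.marked}
  id X := ⟨𝟙 X.obj, Finset.image_id⟩
  comp {X _ _} f g := ⟨f.1 ≫ g.1, by
    have h : X.marked.image (DeltaS.Hom.toFun g.1 ∘ DeltaS.Hom.toFun f.1) = _ :=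
      Finset.image_image.symm
    exact h.trans ((congrArg (Finset.image (DeltaS.Hom.toFun g.1)) f.2).trans g.2)⟩
  id_comp f := Subtype.ext (Category.id_comp f.1)
  comp_id f := Subtype.ext (Category.comp_id f.1)
  assoc f g h := Subtype.ext (Category.assoc f.1 g.1 h.1)

@[ext]
theorem hom_ext {X Y : MarkedDeltaS} {f g : X ⟶ Y} (h : f.1 = g.1) : f = g := Subtype.ext h

theorem mem_marked {X Y : MarkedDeltaS} (f : X ⟶ Y) {i : Fin (Y.obj.len + 1)} :
    i ∈ Y.marked ↔ ∃ j ∈ X.marked, DeltaS.Hom.toFun f.1 j = i :=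
  (Finset.ext_iff.1 f.2 i).symm.trans Finset.mem_image

/-- The functor that forgets the marking. -/
@[simps]
def forget : MarkedDeltaS ⥤ DeltaS where
  obj X := X.obj
  map f := f.1

theorem hom_heq {X X' Y Y' : MarkedDeltaS} (hX : X = X') (hY : Y = Y') {f : X ⟶ Y}
    {g : X' ⟶ Y'} (h : f.1 ≍ g.1) : f ≍ g := by
  subst hX hY
  exact heq_of_eq (hom_ext (eq_of_heq h))

/-- The chain of marked objects over a chain in `ΔS` with prescribed marking of the first object. -/
def liftChain {n : ℕ} (σ : ComposableArrows DeltaS n) (S : Finset (Fin ((σ.obj 0).len + 1))) :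
    ComposableArrows MarkedDeltaS n where
  obj i := ⟨σ.obj i, S.image (DeltaS.Hom.toFun (σ.map (homOfLE (Fin.zero_le i))))⟩
  map {i j} f := ⟨σ.map f, by
    dsimp only
    have h : homOfLE (Fin.zero_le j) = homOfLE (Fin.zero_le i) ≫ f := Subsingleton.elim _ _
    rw [h, σ.map_comp, Finset.image_image]
    rfl⟩
  map_id i := hom_ext (σ.map_id i)
  map_comp f g := hom_ext (σ.map_comp f g)

theorem liftChain_marked_zero {n : ℕ} (σ : ComposableArrows DeltaS n)
    (S : Finset (Fin ((σ.obj 0).len + 1))) : ((liftChain σ S).obj 0).marked = S := by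
  have h : σ.map (homOfLE (Fin.zero_le (0 : Fin (n + 1)))) = 𝟙 (σ.obj 0) := σ.map_id 0
  change S.image (DeltaS.Hom.toFun (σ.map (homOfLE (Fin.zero_le 0)))) = S
  rw [h]
  exact Finset.image_id

theorem liftChain_forget {n : ℕ} (ν : ComposableArrows MarkedDeltaS n) :
    liftChain (ν ⋙ forget) (ν.obj 0).marked = ν := by
  have hobj : ∀ i, (liftChain (ν ⋙ forget) (ν.obj 0).marked).obj i = ν.obj i := fun i =>
    MarkedDeltaS.ext rfl (heq_of_eq (ν.map (homOfLE (Fin.zero_le i))).2)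
  exact CategoryTheory.Functor.hext hobj fun i j f => hom_heq (hobj i) (hobj j) HEq.rfl

end MarkedDeltaS

section MarkedBar

variable {k A : Type u} [CommRing k] [Ring A] [Algebra k A] (ε : A →ₐ[k] k)

theorem bsymMap_mem_markedTensors {X Y : MarkedDeltaS} (f : X ⟶ Y)
    {z : ⨂[k] _ : Fin (X.obj.len + 1), A} (hz : z ∈ markedTensors ε X.marked) :
    bsymMap k A f.1 z ∈ markedTensors ε Y.marked := by
  suffices h : markedTensors ε X.marked ≤ (markedTensors ε Y.marked).comap (bsymMap k A f.1) from
    h hz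
  refine Submodule.span_le.2 ?_
  rintro _ ⟨a, h1, h2, rfl⟩
  change bsymMap k A f.1 (PiTensorProduct.tprod k a) ∈ markedTensors ε Y.marked
  rw [bsymMap_tprod]
  refine tprod_mem_markedTensors (fun i hi => ?_) fun i hi => ?_
  · obtain ⟨j, hj, rfl⟩ := (MarkedDeltaS.mem_marked f).1 hi
    change ε _ = 0
    rw [map_list_prod, List.map_map]
    refine List.prod_eq_zero (List.mem_map.2 ⟨j, (DeltaS.Hom.mem_fiber f.1 _ _).2 rfl, h1 j hj⟩)
  · refine List.prod_eq_one fun x hx => ?_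
    obtain ⟨j, hj, rfl⟩ := List.mem_map.1 hx
    exact h2 j fun h =>
      hi ((MarkedDeltaS.mem_marked f).2 ⟨j, h, (DeltaS.Hom.mem_fiber f.1 _ _).1 hj⟩)

/-- The functor on marked objects that takes `([m], S)` to the submodule `I^{⊗ S}` of
`A^{⊗ m+1}`. -/
noncomputable def markedBsym : MarkedDeltaS ⥤ ModuleCat.{u} k where
  obj X := ModuleCat.of k (markedTensors ε X.marked)
  map f := ModuleCat.ofHom ((bsymMap k A f.1).restrict fun _ => bsymMap_mem_markedTensors ε f)
  map_id X := by
    refine ModuleCat.hom_ext (LinearMap.ext fun z => Subtype.ext ?_)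
    exact congrArg (fun φ => φ.hom z.1) ((Bsym k A).map_id X.obj)
  map_comp f g := by
    refine ModuleCat.hom_ext (LinearMap.ext fun z => Subtype.ext ?_)
    exact congrArg (fun φ => φ.hom z.1) ((Bsym k A).map_comp f.1 g.1)

/-- The inclusion of `I^{⊗ S}` into `A^{⊗ m+1}`, as a natural transformation. -/
noncomputable def markedInclusion : markedBsym ε ⟶ MarkedDeltaS.forget ⋙ Bsym k A where
  app X := ModuleCat.ofHom (markedTensors ε X.marked).subtype
  naturality _ _ _ := rfl

/-- The projection of `A^{⊗ m+1}` onto `I^{⊗ S}`. -/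
noncomputable def toMarked (X : MarkedDeltaS) :
    (Bsym k A).obj X.obj →ₗ[k] (markedBsym ε).obj X :=
  (markedProj ε X.marked).codRestrict (markedTensors ε X.marked) (markedProj_mem ε _)

theorem toMarked_markedInclusion (X : MarkedDeltaS) (y : (markedBsym ε).obj X) :
    toMarked ε X (((markedInclusion ε).app X).hom y) = y :=
  Subtype.ext (markedProj_of_mem y.2)

theorem toMarked_of_mem_of_ne (X : MarkedDeltaS) {S : Finset (Fin (X.obj.len + 1))}
    (h : S ≠ X.marked) {x : (Bsym k A).obj X.obj} (hx : x ∈ markedTensors ε S) :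
    toMarked ε X x = 0 :=
  Subtype.ext (markedProj_of_mem_of_ne h hx)

open Classical in
/-- The inverse of the map from the bar construction on marked objects to the bar construction on
`ΔS`: an element over a chain is projected to the components for all markings of the first
object. -/
noncomputable def markedBarInv (n : ℕ) :
    (⨁ σ : ComposableArrows DeltaS n, (Bsym k A).obj (σ.obj 0)) →ₗ[k]
      ⨁ ν : ComposableArrows MarkedDeltaS n, (markedBsym ε).obj (ν.obj 0) :=
  DirectSum.toModule k _ _ fun σ => ∑ S : Finset (Fin ((σ.obj 0).len + 1)),
    DirectSum.lof k (ComposableArrows MarkedDeltaS n) (fun ν => (markedBsym ε).obj (ν.obj 0))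
        (MarkedDeltaS.liftChain σ S) ∘ₗ toMarked ε ((MarkedDeltaS.liftChain σ S).obj 0)

open Classical in
theorem markedBarInv_lof (n : ℕ) (σ : ComposableArrows DeltaS n) (x : (Bsym k A).obj (σ.obj 0)) :
    markedBarInv ε n (DirectSum.lof k _
        (fun σ : ComposableArrows DeltaS n => (Bsym k A).obj (σ.obj 0)) σ x) =
      ∑ S : Finset (Fin ((σ.obj 0).len + 1)),
        DirectSum.lof k (ComposableArrows MarkedDeltaS n) (fun ν => (markedBsym ε).obj (ν.obj 0))
          (MarkedDeltaS.liftChain σ S) (toMarked ε ((MarkedDeltaS.liftChain σ S).obj 0) x) := by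
  rw [markedBarInv, DirectSum.toModule_lof, LinearMap.sum_apply]
  rfl

theorem barMap_comp_markedBarInv (n : ℕ) :
    barMap MarkedDeltaS.forget (markedInclusion ε) n ∘ₗ markedBarInv ε n = LinearMap.id := by
  classical
  refine DirectSum.linearMap_ext _ fun σ => LinearMap.ext fun x => ?_
  refine (congrArg (barMap MarkedDeltaS.forget (markedInclusion ε) n)
    (markedBarInv_lof ε n σ x)).trans ?_
  let p : Finset (Fin ((σ.obj 0).len + 1)) → (Bsym k A).obj (σ.obj 0) := fun S => markedProj ε S x
  have hp : ∑ S, p S = x := sum_markedProj ε x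
  have h : ∀ S, barMap MarkedDeltaS.forget (markedInclusion ε) n
      (DirectSum.lof k (ComposableArrows MarkedDeltaS n) (fun ν => (markedBsym ε).obj (ν.obj 0))
        (MarkedDeltaS.liftChain σ S) (toMarked ε ((MarkedDeltaS.liftChain σ S).obj 0) x)) =
      DirectSum.lof k _ (fun σ : ComposableArrows DeltaS n => (Bsym k A).obj (σ.obj 0)) σ
        (p S) := fun S => by
    refine (barMap_lof MarkedDeltaS.forget (markedInclusion ε) (MarkedDeltaS.liftChain σ S)
      _).trans (lof_congr rfl (heq_of_eq ?_))
    exact congrArg (fun S => markedProj ε S x) (MarkedDeltaS.liftChain_marked_zero σ S)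
  rw [map_sum, Finset.sum_congr rfl fun S _ => h S, ← map_sum, hp]
  rfl

theorem markedBarInv_comp_barMap (n : ℕ) :
    markedBarInv ε n ∘ₗ barMap MarkedDeltaS.forget (markedInclusion ε) n = LinearMap.id := by
  classical
  refine DirectSum.linearMap_ext _ fun ν => LinearMap.ext fun x => ?_
  obtain ⟨σ, S, rfl⟩ : ∃ σ S, ν = MarkedDeltaS.liftChain σ S :=
    ⟨_, _, (MarkedDeltaS.liftChain_forget ν).symm⟩
  refine (congrArg (markedBarInv ε n) (barMap_lof MarkedDeltaS.forget (markedInclusion ε)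
    (MarkedDeltaS.liftChain σ S) x)).trans ?_
  refine (markedBarInv_lof ε n σ _).trans ?_
  have hS := MarkedDeltaS.liftChain_marked_zero σ S
  refine (Finset.sum_eq_single S (fun T _ hT => ?_) fun h => absurd (Finset.mem_univ S) h).trans ?_
  · have hT' := MarkedDeltaS.liftChain_marked_zero σ T
    have h0 := toMarked_of_mem_of_ne ε ((MarkedDeltaS.liftChain σ T).obj 0)
      (S := ((MarkedDeltaS.liftChain σ S).obj 0).marked)
      (fun h => hT (hT'.symm.trans (h.symm.trans hS))) x.2
    exact (congrArg (DirectSum.lof k (ComposableArrows MarkedDeltaS n)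
      (fun ν => (markedBsym ε).obj (ν.obj 0)) (MarkedDeltaS.liftChain σ T)) h0).trans (map_zero _)
  · exact congrArg (DirectSum.lof k (ComposableArrows MarkedDeltaS n)
      (fun ν => (markedBsym ε).obj (ν.obj 0)) (MarkedDeltaS.liftChain σ S))
      (toMarked_markedInclusion ε _ x)

/-- The complex `L_*(A)` is the bar complex of the modules `I^{⊗ S}` over marked objects, because a
chain of marked objects is a chain in `ΔS` with a marking of its first object. -/
theorem markedBarMap_bijective (n : ℕ) :
    Function.Bijective (barMap MarkedDeltaS.forget (markedInclusion ε) n) :=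
  ⟨Function.LeftInverse.injective (g := markedBarInv ε n)
      fun z => LinearMap.congr_fun (markedBarInv_comp_barMap ε n) z,
    Function.RightInverse.surjective (g := markedBarInv ε n)
      fun z => LinearMap.congr_fun (barMap_comp_markedBarInv ε n) z⟩

end MarkedBar

/-! ### Injective morphisms of `ΔS` -/

namespace DeltaS

/-- A function, regarded as a morphism of `ΔS` by means of the natural order on each fibre. -/
def ofFun {X Y : DeltaS} (h : Fin (X.len + 1) → Fin (Y.len + 1)) : X ⟶ Y :=
  { toFun := h
    fiber := fun i => (List.finRange _).filter fun j => h j = i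
    nodup := fun _ => (List.nodup_finRange _).filter _
    mem_fiber := fun i j => by simp }

theorem fiber_toFun_of_injective {X Y : DeltaS} {f : X ⟶ Y}
    (hf : Function.Injective (Hom.toFun f)) (j : Fin (X.len + 1)) :
    Hom.fiber f (Hom.toFun f j) = [j] := by
  refine List.perm_singleton.1 ((List.perm_ext_iff_of_nodup (Hom.nodup f _)
    (List.nodup_singleton j)).2 fun t => ?_)
  rw [Hom.mem_fiber, List.mem_singleton, hf.eq_iff]

theorem fiber_eq_nil {X Y : DeltaS} {f : X ⟶ Y} {i : Fin (Y.len + 1)}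
    (h : ∀ j, Hom.toFun f j ≠ i) : Hom.fiber f i = [] :=
  List.eq_nil_iff_forall_not_mem.2 fun j hj => h j ((Hom.mem_fiber f i j).1 hj)

/-- Morphisms of `ΔS` with injective underlying function are determined by this function. -/
theorem hom_eq_of_injective {X Y : DeltaS} {f g : X ⟶ Y} (hf : Function.Injective (Hom.toFun f))
    (h : Hom.toFun f = Hom.toFun g) : f = g := by
  refine Hom.ext_fiber (funext fun i => ?_)
  by_cases hi : ∃ j, Hom.toFun f j = i
  · obtain ⟨j, rfl⟩ := hi
    rw [fiber_toFun_of_injective hf, h, fiber_toFun_of_injective (h ▸ hf)]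
  · push Not at hi
    rw [fiber_eq_nil hi, fiber_eq_nil (h ▸ hi)]

theorem fiber_comp_of_injective {X Y Z : DeltaS} (g : X ⟶ Y) {i : Y ⟶ Z}
    (hi : Function.Injective (Hom.toFun i)) (y : Fin (Y.len + 1)) :
    Hom.fiber (g ≫ i) (Hom.toFun i y) = Hom.fiber g y := by
  rw [fiber_comp, fiber_toFun_of_injective hi, List.flatMap_singleton]

theorem eq_of_comp_eq_of_injective {X Y Z : DeltaS} {g h : X ⟶ Y} {i : Y ⟶ Z}
    (hi : Function.Injective (Hom.toFun i)) (w : g ≫ i = h ≫ i) : g = h := by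
  refine Hom.ext_fiber (funext fun y => ?_)
  rw [← fiber_comp_of_injective g hi, w, fiber_comp_of_injective h hi]

/-- A morphism factors through an injective one if its image is contained in that of the latter. -/
theorem exists_comp_eq_of_injective {X Y Z : DeltaS} (g : X ⟶ Z) {i : Y ⟶ Z}
    (hi : Function.Injective (Hom.toFun i)) (h : ∀ x, ∃ y, Hom.toFun i y = Hom.toFun g x) :
    ∃ l : X ⟶ Y, l ≫ i = g := by
  choose l hl using h
  let l' : X ⟶ Y :=
    { toFun := l
      fiber := fun y => Hom.fiber g (Hom.toFun i y)
      nodup := fun _ => Hom.nodup g _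
      mem_fiber := fun y x => by rw [Hom.mem_fiber, ← hl, hi.eq_iff] }
  refine ⟨l', Hom.ext_fiber (funext fun z => ?_)⟩
  by_cases hz : ∃ y, Hom.toFun i y = z
  · obtain ⟨y, rfl⟩ := hz
    exact fiber_comp_of_injective l' hi y
  · push Not at hz
    rw [fiber_comp, fiber_eq_nil hz, List.flatMap_nil, fiber_eq_nil]
    intro x hx
    exact hz (l x) ((hl x).trans hx)

theorem exists_retraction {X Y : DeltaS} {i : X ⟶ Y} (hi : Function.Injective (Hom.toFun i)) :
    ∃ r : Y ⟶ X, i ≫ r = 𝟙 X := by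
  obtain ⟨r, hr⟩ := hi.hasLeftInverse
  have h : Hom.toFun (i ≫ ofFun r) = id := funext hr
  exact ⟨ofFun r, hom_eq_of_injective (h ▸ Function.injective_id) h⟩

/-! ### Adjoining a minimal element -/

/-- The morphism `[m+1] ⟶ [n+1]` that fixes `0` and is `f : [m] ⟶ [n]` on the other elements. -/
def shiftMap {X Y : DeltaS} (f : X ⟶ Y) : DeltaS.mk (X.len + 1) ⟶ DeltaS.mk (Y.len + 1) :=
  { toFun := Fin.cases 0 fun j => (Hom.toFun f j).succ
    fiber := Fin.cases [0] fun i => (Hom.fiber f i).map Fin.succ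
    nodup := fun i => by
      cases i using Fin.cases with
      | zero => exact List.nodup_singleton _
      | succ i => exact (Hom.nodup f i).map (Fin.succ_injective _)
    mem_fiber := fun i j => by
      cases i using Fin.cases <;> cases j using Fin.cases <;>
        simp [Hom.mem_fiber, Fin.succ_ne_zero, (Fin.succ_ne_zero _).symm] }

/-- The functor `[m] ↦ [0] ⊔ [m]` that adjoins a minimal element. -/
def shift : DeltaS ⥤ DeltaS where
  obj X := DeltaS.mk (X.len + 1)
  map f := shiftMap f
  map_id X := by
    refine Hom.ext_fiber (funext fun i => ?_)
    change Fin.cases _ _ i = [i]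
    cases i using Fin.cases <;> simp [fiber_id]
  map_comp f g := by
    refine Hom.ext_fiber (funext fun i => ?_)
    rw [fiber_comp]
    change Fin.cases _ _ i = (Fin.cases _ _ i : List _).flatMap (Fin.cases _ _)
    cases i using Fin.cases <;> simp [fiber_comp, List.map_flatMap, List.flatMap_map]

/-- The inclusion of `[m]` into `[0] ⊔ [m]`. -/
def toShiftMap (X : DeltaS) : X ⟶ DeltaS.mk (X.len + 1) :=
  { toFun := Fin.succ
    fiber := Fin.cases [] fun i => [i]
    nodup := fun i => by
      cases i using Fin.cases with
      | zero => exact List.nodup_nil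
      | succ i => exact List.nodup_singleton i
    mem_fiber := fun i j => by
      cases i using Fin.cases with
      | zero => simp [Fin.succ_ne_zero]
      | succ i => simp }

/-- The inclusion of `[m]` into `[0] ⊔ [m]`, as a natural transformation. -/
def toShift : 𝟭 DeltaS ⟶ shift where
  app X := toShiftMap X
  naturality X Y f := by
    refine Hom.ext_fiber (funext fun i => ?_)
    cases i using Fin.cases with
    | zero => rfl
    | succ i =>
      change [i].flatMap (Hom.fiber f) =
        ((Hom.fiber f i).map Fin.succ).flatMap (Hom.fiber (toShiftMap X))
      rw [List.flatMap_map]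
      exact (List.flatMap_singleton (Hom.fiber f) i).trans
        (List.flatMap_singleton' (Hom.fiber f i)).symm

theorem toFun_toShift_injective (X : DeltaS) :
    Function.Injective (Hom.toFun (toShift.app X)) := Fin.succ_injective _

end DeltaS

namespace MarkedDeltaS

theorem exists_comp_eq_of_injective {X Y Z : MarkedDeltaS} (g : X ⟶ Z) {i : Y ⟶ Z}
    (hi : Function.Injective (DeltaS.Hom.toFun i.1))
    (h : ∀ x, ∃ y, DeltaS.Hom.toFun i.1 y = DeltaS.Hom.toFun g.1 x) :
    ∃ l : X ⟶ Y, l ≫ i = g := by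
  obtain ⟨l, hl⟩ := DeltaS.exists_comp_eq_of_injective g.1 hi h
  refine ⟨⟨l, Finset.image_injective hi ?_⟩, hom_ext hl⟩
  have h1 : (X.marked.image (DeltaS.Hom.toFun l)).image (DeltaS.Hom.toFun i.1) =
      X.marked.image (DeltaS.Hom.toFun g.1) := by
    rw [← hl, Finset.image_image]
    rfl
  exact h1.trans (g.2.trans i.2.symm)

theorem eq_of_comp_eq_of_injective {X Y Z : MarkedDeltaS} {g h : X ⟶ Y} {i : Y ⟶ Z}
    (hi : Function.Injective (DeltaS.Hom.toFun i.1)) (w : g ≫ i = h ≫ i) : g = h :=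
  hom_ext (DeltaS.eq_of_comp_eq_of_injective hi (congrArg Subtype.val w))

/-- The functor that adjoins an unmarked minimal element. -/
def shift : MarkedDeltaS ⥤ MarkedDeltaS where
  obj X := ⟨DeltaS.shift.obj X.obj, X.marked.image Fin.succ⟩
  map {X Y} f := ⟨DeltaS.shift.map f.1, by
    have h : (X.marked.image Fin.succ).image (DeltaS.Hom.toFun (DeltaS.shiftMap f.1)) =
        (X.marked.image (DeltaS.Hom.toFun f.1)).image Fin.succ := by
      rw [Finset.image_image, Finset.image_image]
      rfl
    exact h.trans (congrArg _ f.2)⟩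
  map_id X := hom_ext (DeltaS.shift.map_id X.obj)
  map_comp f g := hom_ext (DeltaS.shift.map_comp f.1 g.1)

/-- The inclusion of a marked object `[m]` into `[0] ⊔ [m]`. -/
def toShift : 𝟭 MarkedDeltaS ⟶ shift where
  app X := ⟨DeltaS.toShift.app X.obj, rfl⟩
  naturality _ _ f := hom_ext (DeltaS.toShift.naturality f.1)

/-- The marked objects that occur in the decomposition of `B^sym I`: those in which all elements are
marked, and `[0]` with any marking. -/
def IsReduced : ObjectProperty MarkedDeltaS := fun X => X.marked = Finset.univ ∨ X.obj.len = 0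

theorem IsReduced.eq_univ {X : MarkedDeltaS} (h : IsReduced X) (hX : X.marked.Nonempty) :
    X.marked = Finset.univ := by
  refine h.elim id fun h => ?_
  have := hX.card_pos
  refine Finset.eq_univ_of_card _ (le_antisymm (Finset.card_le_univ _) ?_)
  rw [Fintype.card_fin]
  omega

theorem IsReduced.len_eq_zero {X : MarkedDeltaS} (h : IsReduced X) (hX : X.marked = ∅) :
    X.obj.len = 0 :=
  h.resolve_left fun h => Finset.univ_nonempty.ne_empty (h.symm.trans hX)

/-- The set of elements of `[0] ⊔ [m]` that consists of the marked elements of `[m]` if there are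
any, and of `0` otherwise. It is non-empty, so that it is the image of an object of `ΔS`, and
morphisms preserve it, which would fail for an element of `[m]` chosen in place of `0`. -/
def support (X : MarkedDeltaS) : Finset (Fin (X.obj.len + 1 + 1)) :=
  if X.marked = ∅ then {0} else X.marked.image Fin.succ

theorem card_support (X : MarkedDeltaS) : X.support.card = X.marked.card - 1 + 1 := by
  rw [support]
  split_ifs with h
  · simp [h]
  · rw [Finset.card_image_of_injective _ (Fin.succ_injective _)]
    have := Finset.card_pos.2 (Finset.nonempty_iff_ne_empty.2 h)
    omega

/-- The reduced object whose elements are the marked elements of `X`, or `[0]` without marked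
elements if there are none. -/
def reduceObj (X : MarkedDeltaS) : MarkedDeltaS :=
  ⟨DeltaS.mk (X.marked.card - 1), if X.marked = ∅ then ∅ else Finset.univ⟩

theorem isReduced_reduceObj (X : MarkedDeltaS) : IsReduced X.reduceObj := by
  by_cases h : X.marked = ∅
  · exact Or.inr (by simp [reduceObj, h])
  · exact Or.inl (if_neg h)

/-- The order-preserving enumeration of the support of `X`. -/
def reduceToShift (X : MarkedDeltaS) : X.reduceObj ⟶ shift.obj X :=
  ⟨DeltaS.ofFun (X.support.orderEmbOfFin X.card_support), by
    change (if X.marked = ∅ then ∅ else Finset.univ).image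
      (X.support.orderEmbOfFin X.card_support) = X.marked.image Fin.succ
    split_ifs with h
    · simp [h]
    · rw [Finset.image_orderEmbOfFin_univ, support, if_neg h]⟩

theorem toFun_reduceToShift_injective (X : MarkedDeltaS) :
    Function.Injective (DeltaS.Hom.toFun X.reduceToShift.1) :=
  (X.support.orderEmbOfFin X.card_support).injective

theorem exists_reduceToShift_eq {X : MarkedDeltaS} {i : Fin (X.obj.len + 1 + 1)} :
    (∃ j, DeltaS.Hom.toFun X.reduceToShift.1 j = i) ↔ i ∈ X.support := by
  have h := Finset.range_orderEmbOfFin X.support X.card_support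
  rw [← Finset.mem_coe, ← h]
  rfl

theorem marked_eq_empty_iff {X Y : MarkedDeltaS} (f : X ⟶ Y) :
    Y.marked = ∅ ↔ X.marked = ∅ := by
  have h := f.2
  rw [← Finset.image_eq_empty (f := DeltaS.Hom.toFun f.1), h]

theorem shift_map_mem_support {X Y : MarkedDeltaS} (f : X ⟶ Y) {i : Fin (X.obj.len + 1 + 1)}
    (hi : i ∈ X.support) : DeltaS.Hom.toFun (shift.map f).1 i ∈ Y.support := by
  have hY := marked_eq_empty_iff f
  by_cases h : X.marked = ∅
  · rw [support, if_pos h, Finset.mem_singleton] at hi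
    rw [support, if_pos (hY.2 h), hi]
    exact Finset.mem_singleton_self _
  · rw [support, if_neg h] at hi
    rw [support, if_neg (mt hY.1 h)]
    exact (mem_marked (shift.map f)).2 ⟨i, hi, rfl⟩

theorem exists_reduceMap {X Y : MarkedDeltaS} (f : X ⟶ Y) :
    ∃ l : X.reduceObj ⟶ Y.reduceObj, l ≫ Y.reduceToShift = X.reduceToShift ≫ shift.map f :=
  exists_comp_eq_of_injective _ Y.toFun_reduceToShift_injective fun _ =>
    exists_reduceToShift_eq.2 (shift_map_mem_support f (exists_reduceToShift_eq.1 ⟨_, rfl⟩))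

/-- The functor that discards the elements that are not marked; an object without marked elements
goes to `[0]`. -/
noncomputable def reduce : MarkedDeltaS ⥤ IsReduced.FullSubcategory where
  obj X := ⟨X.reduceObj, X.isReduced_reduceObj⟩
  map f := ObjectProperty.homMk (exists_reduceMap f).choose
  map_id X := ObjectProperty.hom_ext _ <|
    eq_of_comp_eq_of_injective X.toFun_reduceToShift_injective <| by
      refine (exists_reduceMap (𝟙 X)).choose_spec.trans ?_
      rw [shift.map_id, Category.comp_id]
      exact (Category.id_comp _).symm
  map_comp {X Y Z} f g := ObjectProperty.hom_ext _ <|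
    eq_of_comp_eq_of_injective Z.toFun_reduceToShift_injective <| by
      refine (exists_reduceMap (f ≫ g)).choose_spec.trans ?_
      refine Eq.trans ?_ (Category.assoc (exists_reduceMap f).choose (exists_reduceMap g).choose
        Z.reduceToShift).symm
      rw [(exists_reduceMap g).choose_spec, ← Category.assoc, (exists_reduceMap f).choose_spec,
        shift.map_comp, Category.assoc]

/-- The enumerations of the supports form a natural transformation. -/
noncomputable def reduceToShiftNat : reduce ⋙ IsReduced.ι ⟶ shift where
  app X := X.reduceToShift
  naturality _ _ f := (exists_reduceMap f).choose_spec

theorem IsReduced.card_sub_one {X : MarkedDeltaS} (h : IsReduced X) :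
    X.marked.card - 1 = X.obj.len := by
  obtain h | h := h
  · rw [h, Finset.card_univ, Fintype.card_fin, Nat.add_sub_cancel]
  · have := Finset.card_le_univ X.marked
    rw [Fintype.card_fin] at this
    omega

/-- The reduction of a reduced object is this object. -/
def fromReduce {X : MarkedDeltaS} (h : IsReduced X) : X.reduceObj ⟶ X :=
  ⟨DeltaS.ofFun (X := DeltaS.mk (X.marked.card - 1))
      (Fin.cast (congrArg (· + 1) h.card_sub_one)), by
    change (if X.marked = ∅ then ∅ else Finset.univ).image
      (Fin.cast (congrArg (· + 1) h.card_sub_one)) = X.marked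
    split_ifs with h'
    · exact Finset.image_empty _ |>.trans h'.symm
    · refine Eq.trans ?_ (h.eq_univ (Finset.nonempty_iff_ne_empty.2 h')).symm
      exact Finset.image_univ_of_surjective
        (finCongr (congrArg (· + 1) h.card_sub_one)).surjective⟩

theorem toFun_fromReduce_injective {X : MarkedDeltaS} (h : IsReduced X) :
    Function.Injective (DeltaS.Hom.toFun (fromReduce h).1) := by
  intro a b hab
  exact (finCongr (congrArg (· + 1) h.card_sub_one)).injective hab

/-- Without marked elements this would fail: `toShift` then misses the support `{0}`. -/
theorem fromReduce_comp_toShift {X : MarkedDeltaS} (h : IsReduced X) (hX : X.marked.Nonempty) :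
    fromReduce h ≫ toShift.app X = X.reduceToShift := by
  refine hom_ext (DeltaS.hom_eq_of_injective ?_ ?_)
  · exact (Fin.succ_injective _).comp (toFun_fromReduce_injective h)
  · refine Finset.orderEmbOfFin_unique X.card_support (fun x => ?_) ?_
    · rw [support, if_neg hX.ne_empty, h.eq_univ hX]
      exact Finset.mem_image_of_mem _ (Finset.mem_univ _)
    · intro a b hab
      exact Fin.succ_lt_succ_iff.2 (show a.cast (congrArg (· + 1) h.card_sub_one) <
        b.cast (congrArg (· + 1) h.card_sub_one) from hab)

/-- The naturality of `fromReduce`. -/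
theorem comp_fromReduce_eq {X Y : MarkedDeltaS} (hX : IsReduced X) (hY : IsReduced Y)
    (f : X ⟶ Y) (l : X.reduceObj ⟶ Y.reduceObj)
    (hl : l ≫ Y.reduceToShift = X.reduceToShift ≫ shift.map f) :
    l ≫ fromReduce hY = fromReduce hX ≫ f := by
  have hXY := marked_eq_empty_iff f
  by_cases h : Y.marked = ∅
  · -- Without marked elements both objects are `[0]`, which has no other endomorphism.
    have h0 : X.marked.card - 1 = 0 := by rw [hXY.1 h, Finset.card_empty]
    have : Subsingleton (Fin (Y.obj.len + 1)) := by
      rw [hY.len_eq_zero h]; exact inferInstanceAs (Subsingleton (Fin 1))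
    have : Subsingleton (Fin (X.reduceObj.obj.len + 1)) := by
      change Subsingleton (Fin (X.marked.card - 1 + 1))
      rw [h0]; exact inferInstanceAs (Subsingleton (Fin 1))
    exact hom_ext (DeltaS.hom_eq_of_injective (Function.injective_of_subsingleton _)
      (Subsingleton.elim _ _))
  · have hY' := Finset.nonempty_iff_ne_empty.2 h
    have hX' := Finset.nonempty_iff_ne_empty.2 (mt hXY.2 h)
    refine eq_of_comp_eq_of_injective (i := toShift.app Y)
      (DeltaS.toFun_toShift_injective Y.obj) ?_
    rw [Category.assoc, Category.assoc, fromReduce_comp_toShift hY hY', hl,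
      ← fromReduce_comp_toShift hX hX', Category.assoc]
    exact congrArg _ (toShift.naturality f).symm

/-- The identification of the reduction of a reduced object with this object, as a natural
transformation. -/
noncomputable def fromReduceNat : IsReduced.ι ⋙ reduce ⟶ 𝟭 IsReduced.FullSubcategory where
  app X := ObjectProperty.homMk (fromReduce X.property)
  naturality X Y f := ObjectProperty.hom_ext _
    (comp_fromReduce_eq X.property Y.property f.hom _ (exists_reduceMap f.hom).choose_spec)

end MarkedDeltaS

/-! ### Reduction to reduced marked objects -/

section Reduction

variable {k A : Type u} [CommRing k] [Ring A] [Algebra k A] (ε : A →ₐ[k] k)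

theorem bsymMap_injective {X Y : DeltaS} {i : X ⟶ Y}
    (hi : Function.Injective (DeltaS.Hom.toFun i)) : Function.Injective (bsymMap k A i) := by
  obtain ⟨r, hr⟩ := DeltaS.exists_retraction hi
  have h : (Bsym k A).map i ≫ (Bsym k A).map r = 𝟙 _ := by
    rw [← (Bsym k A).map_comp, hr, (Bsym k A).map_id]
  exact Function.LeftInverse.injective (g := bsymMap k A r) fun z =>
    congrArg (fun φ => φ.hom z) h

/-- An injective map of marked objects is a bijection on marked elements, and the unmarked places
carry factors `1`, whether or not they are in the image. -/
theorem isIso_markedBsym_map {X Y : MarkedDeltaS} (f : X ⟶ Y)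
    (hf : Function.Injective (DeltaS.Hom.toFun f.1)) : IsIso ((markedBsym ε).map f) := by
  rw [ConcreteCategory.isIso_iff_bijective]
  constructor
  · exact fun x y h => Subtype.ext (bsymMap_injective hf (congrArg Subtype.val h))
  · rintro ⟨y, hy⟩
    suffices h : markedTensors ε Y.marked ≤ (markedTensors ε X.marked).map (bsymMap k A f.1) by
      obtain ⟨x, hx, hxy⟩ := h hy
      exact ⟨⟨x, hx⟩, Subtype.ext hxy⟩
    refine Submodule.span_le.2 ?_
    rintro _ ⟨b, h1, h2, rfl⟩
    refine ⟨PiTensorProduct.tprod k fun j => b (DeltaS.Hom.toFun f.1 j),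
      tprod_mem_markedTensors (fun j hj => ?_) (fun j hj => ?_), ?_⟩
    · exact h1 _ ((MarkedDeltaS.mem_marked f).2 ⟨j, hj, rfl⟩)
    · refine h2 _ fun h => hj ?_
      obtain ⟨j', hj', h⟩ := (MarkedDeltaS.mem_marked f).1 h
      exact hf h ▸ hj'
    · rw [bsymMap_tprod]
      congr 1
      funext i
      by_cases hi : ∃ j, DeltaS.Hom.toFun f.1 j = i
      · obtain ⟨j, rfl⟩ := hi
        rw [DeltaS.fiber_toFun_of_injective hf]
        simp
      · push Not at hi
        rw [DeltaS.fiber_eq_nil hi, h2 i]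
        · rfl
        · intro h
          obtain ⟨j, _, h⟩ := (MarkedDeltaS.mem_marked f).1 h
          exact hi j h

/-- If no element is marked then the module is spanned by `1 ⊗ ⋯ ⊗ 1`, which all morphisms
preserve. -/
theorem markedBsym_map_eq_of_marked_eq_empty {X Y : MarkedDeltaS} (hX : X.marked = ∅)
    (f g : X ⟶ Y) : (markedBsym ε).map f = (markedBsym ε).map g := by
  refine ModuleCat.hom_ext (LinearMap.ext fun z => Subtype.ext ?_)
  refine LinearMap.eqOn_span' (f := bsymMap k A f.1) (g := bsymMap k A g.1) ?_ z.2
  rintro _ ⟨a, -, h2, rfl⟩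
  have ha : ∀ j, a j = 1 := fun j => h2 j (by simp [hX])
  rw [bsymMap_tprod, bsymMap_tprod]
  congr 1
  funext i
  rw [List.prod_eq_one, List.prod_eq_one] <;>
  · intro x hx
    obtain ⟨j, -, rfl⟩ := List.mem_map.1 hx
    exact ha j

instance : IsIso (Functor.whiskerRight MarkedDeltaS.reduceToShiftNat (markedBsym ε)) :=
  have : ∀ X, IsIso ((Functor.whiskerRight MarkedDeltaS.reduceToShiftNat (markedBsym ε)).app X) :=
    fun X => isIso_markedBsym_map ε _ X.toFun_reduceToShift_injective
  NatIso.isIso_of_isIso_app _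

/-- The identification of `I^{⊗ S}` with the module attached to the reduction of `([m], S)`. -/
noncomputable def markedBsymReduce : markedBsym ε ⟶
    MarkedDeltaS.reduce ⋙ MarkedDeltaS.IsReduced.ι ⋙ markedBsym ε :=
  Functor.whiskerRight MarkedDeltaS.toShift (markedBsym ε) ≫
    inv (Functor.whiskerRight MarkedDeltaS.reduceToShiftNat (markedBsym ε))

theorem markedBsymReduce_app_comp (X : MarkedDeltaS) :
    (markedBsymReduce ε).app X ≫ (markedBsym ε).map (MarkedDeltaS.reduceToShiftNat.app X) =
      (markedBsym ε).map (MarkedDeltaS.toShift.app X) := by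
  have h : markedBsymReduce ε ≫ Functor.whiskerRight MarkedDeltaS.reduceToShiftNat (markedBsym ε) =
      Functor.whiskerRight MarkedDeltaS.toShift (markedBsym ε) := by
    rw [markedBsymReduce, Category.assoc, IsIso.inv_hom_id, Category.comp_id]
  exact congrArg (fun η => η.app X) h

theorem markedBsymReduce_app_comp_fromReduce {X : MarkedDeltaS}
    (hX : MarkedDeltaS.IsReduced X) :
    (markedBsymReduce ε).app X ≫ (markedBsym ε).map (MarkedDeltaS.fromReduce hX) = 𝟙 _ := by
  have h1 : (markedBsym ε).map (MarkedDeltaS.fromReduce hX) ≫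
      (markedBsym ε).map (MarkedDeltaS.toShift.app X) =
      (markedBsym ε).map (MarkedDeltaS.reduceToShiftNat.app X) := by
    rw [← (markedBsym ε).map_comp]
    obtain h | h := X.marked.eq_empty_or_nonempty
    · exact markedBsym_map_eq_of_marked_eq_empty ε (if_pos h) _ _
    · exact congrArg _ (MarkedDeltaS.fromReduce_comp_toShift hX h)
  have h2 := isIso_markedBsym_map ε (MarkedDeltaS.toShift.app X)
    (DeltaS.toFun_toShift_injective X.obj)
  refine (cancel_mono ((markedBsym ε).map (MarkedDeltaS.toShift.app X))).1 ?_
  exact (Category.assoc _ _ _).trans ((congrArg (fun φ => (markedBsymReduce ε).app X ≫ φ) h1).trans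
    ((markedBsymReduce_app_comp ε X).trans (Category.id_comp _).symm))

/-- The restriction of the functor `([m], S) ↦ I^{⊗ S}` to reduced marked objects. -/
noncomputable abbrev reducedBsym : MarkedDeltaS.IsReduced.FullSubcategory ⥤ ModuleCat.{u} k :=
  MarkedDeltaS.IsReduced.ι ⋙ markedBsym ε

/-- The inclusion of the bar complex over reduced marked objects into the bar complex over all
marked objects. -/
noncomputable abbrev reducedBarInclusion : barComplex (reducedBsym ε) ⟶ barComplex (markedBsym ε) :=
  barComplexMap MarkedDeltaS.IsReduced.ι (𝟙 (reducedBsym ε))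

/-- Discarding the elements that are not marked defines a map of bar complexes. -/
noncomputable abbrev reducedBarRetraction :
    barComplex (markedBsym ε) ⟶ barComplex (reducedBsym ε) :=
  barComplexMap MarkedDeltaS.reduce (markedBsymReduce ε)

/-- The morphisms `fromReduce` give a homotopy from the composite of `reducedBarInclusion` with
`reducedBarRetraction` to the identity. -/
noncomputable def reducedBarHomotopy :
    Homotopy (reducedBarInclusion ε ≫ reducedBarRetraction ε) (𝟙 (barComplex (reducedBsym ε))) :=
  let γ : reducedBsym ε ⟶ (MarkedDeltaS.IsReduced.ι ⋙ MarkedDeltaS.reduce) ⋙ reducedBsym ε :=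
    Functor.whiskerLeft MarkedDeltaS.IsReduced.ι (markedBsymReduce ε)
  have h : ∀ X, γ.app X = (𝟙 (reducedBsym ε) : reducedBsym ε ⟶ reducedBsym ε).app X ≫
      (markedBsymReduce ε).app (MarkedDeltaS.IsReduced.ι.obj X) :=
    fun _ => (Category.id_comp _).symm
  ((Homotopy.ofEq (barComplexMap_comp MarkedDeltaS.IsReduced.ι (𝟙 (reducedBsym ε))
      MarkedDeltaS.reduce (markedBsymReduce ε) γ h)).trans
    (barComplexHomotopy γ MarkedDeltaS.fromReduceNat
      (reducedBsym ε).leftUnitor.inv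
      fun X => (markedBsymReduce_app_comp_fromReduce ε X.property).symm)).trans
        (Homotopy.ofEq (barComplexMap_id (reducedBsym ε)))

/-- The morphisms from the reduction of `([m], S)` and from `([m], S)` itself to `[0] ⊔ [m]` give
homotopies between the other composite and the identity. -/
noncomputable def markedBarHomotopy :
    Homotopy (reducedBarRetraction ε ≫ reducedBarInclusion ε) (𝟙 (barComplex (markedBsym ε))) :=
  let γ : markedBsym ε ⟶ (MarkedDeltaS.reduce ⋙ MarkedDeltaS.IsReduced.ι) ⋙ markedBsym ε :=
    markedBsymReduce ε
  let δ : markedBsym ε ⟶ MarkedDeltaS.shift ⋙ markedBsym ε :=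
    Functor.whiskerRight MarkedDeltaS.toShift (markedBsym ε)
  have h : ∀ X, γ.app X = (markedBsymReduce ε).app X ≫
      (𝟙 (reducedBsym ε) : reducedBsym ε ⟶ reducedBsym ε).app (MarkedDeltaS.reduce.obj X) :=
    fun _ => (Category.comp_id _).symm
  ((Homotopy.ofEq (barComplexMap_comp MarkedDeltaS.reduce (markedBsymReduce ε)
      MarkedDeltaS.IsReduced.ι (𝟙 (reducedBsym ε)) γ h)).trans
    (barComplexHomotopy γ MarkedDeltaS.reduceToShiftNat δ
      fun X => (markedBsymReduce_app_comp ε X).symm)).trans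
    (barComplexHomotopyOfId MarkedDeltaS.toShift δ fun _ => rfl).symm

/-- The inclusion of reduced marked objects induces a homotopy equivalence. -/
noncomputable def reducedBarHomotopyEquiv :
    HomotopyEquiv (barComplex (reducedBsym ε)) (barComplex (markedBsym ε)) where
  hom := reducedBarInclusion ε
  inv := reducedBarRetraction ε
  homotopyHomInvId := reducedBarHomotopy ε
  homotopyInvHomId := markedBarHomotopy ε

theorem reducedBarInclusion_injective (n : ℕ) :
    Function.Injective (barMap MarkedDeltaS.IsReduced.ι (𝟙 (reducedBsym ε)) n) := by
  refine barMap_injective _ _ (fun ν ν' h => ?_) fun X => Function.injective_id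
  have key : ∀ (τ τ' : ComposableArrows MarkedDeltaS n) (hτ : ∀ i, MarkedDeltaS.IsReduced (τ.obj i))
      (hτ' : ∀ i, MarkedDeltaS.IsReduced (τ'.obj i)), τ = τ' →
      MarkedDeltaS.IsReduced.lift τ hτ = MarkedDeltaS.IsReduced.lift τ' hτ' := by
    rintro τ _ _ _ rfl
    rfl
  exact key (ν ⋙ MarkedDeltaS.IsReduced.ι) (ν' ⋙ MarkedDeltaS.IsReduced.ι)
    (fun i => (ν.obj i).property) (fun i => (ν'.obj i).property) h

end Reduction

/-! ### Reduced marked objects and epimorphisms of `ΔS` -/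

theorem DeltaS.surjective_of_epi {X Y : DeltaS} (f : X ⟶ Y) [Epi f] :
    Function.Surjective (DeltaS.Hom.toFun f) := fun t => by
  obtain ⟨j, hj⟩ := List.exists_mem_of_ne_nil _ (DeltaS.fiber_ne_nil_of_epi f t)
  exact ⟨j, (DeltaS.Hom.mem_fiber f t j).1 hj⟩

/-- A list of elements of the target of a surjective morphism is recovered from the concatenation of
the fibres over its members. -/
theorem DeltaS.flatMap_fiber_injective {X Y : DeltaS} {f : X ⟶ Y}
    (hf : Function.Surjective (DeltaS.Hom.toFun f)) :
    ∀ l l' : List (Fin (Y.len + 1)),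
      l.flatMap (DeltaS.Hom.fiber f) = l'.flatMap (DeltaS.Hom.fiber f) → l = l' := by
  have hne : ∀ y, ∃ x t, DeltaS.Hom.fiber f y = x :: t ∧ DeltaS.Hom.toFun f x = y := fun y => by
    obtain ⟨x, hx⟩ := hf y
    obtain ⟨a, t, h⟩ := List.exists_cons_of_ne_nil
      (List.ne_nil_of_mem ((DeltaS.Hom.mem_fiber f y x).2 hx))
    exact ⟨a, t, h, (DeltaS.Hom.mem_fiber f y a).1 (h ▸ List.mem_cons_self)⟩
  intro l
  induction l with
  | nil =>
    intro l' h
    cases l' with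
    | nil => rfl
    | cons b l' =>
      obtain ⟨x, t, hx, -⟩ := hne b
      simp [hx] at h
  | cons a l ih =>
    intro l' h
    obtain ⟨x, t, hx, hxa⟩ := hne a
    cases l' with
    | nil => simp [hx] at h
    | cons b l' =>
      obtain ⟨y, s, hy, hyb⟩ := hne b
      rw [List.flatMap_cons, List.flatMap_cons] at h
      have hab : a = b := by
        have h' := h
        rw [hx, hy, List.cons_append, List.cons_append, List.cons.injEq] at h'
        rw [← hxa, ← hyb, h'.1]
      subst hab
      rw [ih l' (List.append_cancel_left h)]

theorem DeltaS.epi_of_surjective {X Y : DeltaS} {f : X ⟶ Y}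
    (hf : Function.Surjective (DeltaS.Hom.toFun f)) : Epi f where
  left_cancellation _ _ w := DeltaS.Hom.ext_fiber <| funext fun z =>
    DeltaS.flatMap_fiber_injective hf _ _ (congrArg (fun φ => DeltaS.Hom.fiber φ z) w)

namespace MarkedDeltaS

theorem IsReduced.surjective {X Y : MarkedDeltaS} (hY : IsReduced Y) (f : X ⟶ Y) :
    Function.Surjective (DeltaS.Hom.toFun f.1) := by
  intro y
  obtain h | h := hY
  · obtain ⟨j, -, hj⟩ := (mem_marked f).1 (h ▸ Finset.mem_univ y)
    exact ⟨j, hj⟩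
  · have : Subsingleton (Fin (Y.obj.len + 1)) := by
      rw [h]; exact inferInstanceAs (Subsingleton (Fin 1))
    exact ⟨0, Subsingleton.elim _ _⟩

/-- The functor that forgets the marking of a reduced object. -/
def forgetReduced : IsReduced.FullSubcategory ⥤ EpiDeltaS where
  obj X := ⟨X.obj.obj⟩
  map {_ Y} f := ⟨f.hom.1, DeltaS.epi_of_surjective (Y.property.surjective f.hom)⟩

theorem isReduced_image {X Y : DeltaS} (f : X ⟶ Y) [Epi f] {S : Finset (Fin (X.len + 1))}
    (h : IsReduced ⟨X, S⟩) : IsReduced ⟨Y, S.image (DeltaS.Hom.toFun f)⟩ := by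
  have hf := DeltaS.surjective_of_epi f
  obtain h | h := h
  · refine Or.inl ?_
    rw [show S = Finset.univ from h]
    exact Finset.image_univ_of_surjective hf
  · refine Or.inr ?_
    have := Fintype.card_le_of_surjective _ hf
    simp only [Fintype.card_fin] at this h ⊢
    omega

/-- The chain of reduced marked objects over a chain of epimorphisms. -/
def liftEpiChain {n : ℕ} (σ : ComposableArrows EpiDeltaS n)
    {S : Finset (Fin ((σ.obj 0).obj.len + 1))} (h : IsReduced ⟨(σ.obj 0).obj, S⟩) :
    ComposableArrows IsReduced.FullSubcategory n :=
  IsReduced.lift (liftChain (σ ⋙ wideSubcategoryInclusion _) S) fun i =>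
    isReduced_image (σ.map (homOfLE (Fin.zero_le i))).hom h

end MarkedDeltaS

section EpiBar

variable {k A : Type u} [CommRing k] [Ring A] [Algebra k A] (ε : A →ₐ[k] k)

/-- The projection of `A` onto the tensor factors of `B^sym_m I`. -/
noncomputable def factorProj (m : ℕ) : A →ₗ[k] bsymFactor ε m :=
  (if m = 0 then LinearMap.id else LinearMap.id - augProj ε).codRestrict (bsymFactor ε m)
    fun a => by
      split_ifs with h
      · simp [bsymFactor, h]
      · rw [bsymFactor, if_neg h]
        exact sub_augProj_mem ε a

theorem factorProj_of_mem {m : ℕ} {a : A} (ha : a ∈ bsymFactor ε m) :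
    (factorProj ε m a : A) = a := by
  rw [factorProj, LinearMap.codRestrict_apply]
  split_ifs with h
  · rfl
  · rw [bsymFactor, if_neg h] at ha
    rw [LinearMap.sub_apply, augProj_of_mem ha, sub_zero, LinearMap.id_apply]

/-- The inclusion of `B^sym_m I` into `A^{⊗ m+1}`. -/
noncomputable def factorInclusion (m : ℕ) :
    (⨂[k] _ : Fin (m + 1), bsymFactor ε m) →ₗ[k] ⨂[k] _ : Fin (m + 1), A :=
  PiTensorProduct.map fun _ => (bsymFactor ε m).subtype

/-- The projection of `A^{⊗ m+1}` onto `B^sym_m I`. -/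
noncomputable def factorRetraction (m : ℕ) :
    (⨂[k] _ : Fin (m + 1), A) →ₗ[k] ⨂[k] _ : Fin (m + 1), bsymFactor ε m :=
  PiTensorProduct.map fun _ => factorProj ε m

theorem factorRetraction_factorInclusion (m : ℕ) (x : ⨂[k] _ : Fin (m + 1), bsymFactor ε m) :
    factorRetraction ε m (factorInclusion ε m x) = x := by
  rw [← LinearMap.comp_apply, factorRetraction, factorInclusion, ← PiTensorProduct.map_comp]
  have h : factorProj ε m ∘ₗ (bsymFactor ε m).subtype = LinearMap.id :=
    LinearMap.ext fun a => Subtype.ext (factorProj_of_mem ε a.2)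
  simp_rw [h]
  rw [PiTensorProduct.map_id, LinearMap.id_apply]

theorem factorInclusion_injective (m : ℕ) : Function.Injective (factorInclusion ε m) :=
  Function.LeftInverse.injective (factorRetraction_factorInclusion ε m)

theorem factorInclusion_factorRetraction {X : MarkedDeltaS} (hX : MarkedDeltaS.IsReduced X)
    {z : ⨂[k] _ : Fin (X.obj.len + 1), A} (hz : z ∈ markedTensors ε X.marked) :
    factorInclusion ε X.obj.len (factorRetraction ε X.obj.len z) = z := by
  refine LinearMap.eqOn_span' (f := factorInclusion ε X.obj.len ∘ₗ factorRetraction ε X.obj.len)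
    (g := LinearMap.id) ?_ hz
  rintro _ ⟨a, h1, -, rfl⟩
  rw [LinearMap.comp_apply, factorRetraction, PiTensorProduct.map_tprod, factorInclusion,
    PiTensorProduct.map_tprod, LinearMap.id_apply]
  congr 1
  funext j
  refine factorProj_of_mem ε ?_
  by_cases h : X.obj.len = 0
  · simp [bsymFactor, h]
  · rw [bsymFactor, if_neg h]
    exact h1 j (hX.resolve_right h ▸ Finset.mem_univ j)

theorem factorInclusion_mem_markedTensors {m : ℕ} (hm : m ≠ 0)
    (x : ⨂[k] _ : Fin (m + 1), bsymFactor ε m) :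
    factorInclusion ε m x ∈ markedTensors ε Finset.univ := by
  induction x using PiTensorProduct.induction_on with
  | add x y hx hy => rw [map_add]; exact add_mem hx hy
  | smul_tprod r a =>
    rw [map_smul, factorInclusion, PiTensorProduct.map_tprod]
    refine Submodule.smul_mem _ _ (tprod_mem_markedTensors (fun j _ => ?_)
      fun j hj => absurd (Finset.mem_univ j) hj)
    exact (if_neg hm : bsymFactor ε m = augIdeal ε) ▸ (a j).2

theorem sum_factorRetraction_markedProj (m : ℕ) (x : ⨂[k] _ : Fin (m + 1), bsymFactor ε m) :
    ∑ S, factorRetraction ε m (markedProj ε S (factorInclusion ε m x)) = x := by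
  rw [← map_sum, sum_markedProj, factorRetraction_factorInclusion]

theorem factorRetraction_markedProj_eq_zero {X : DeltaS} {S : Finset (Fin (X.len + 1))}
    (h : ¬ MarkedDeltaS.IsReduced ⟨X, S⟩) (x : ⨂[k] _ : Fin (X.len + 1), bsymFactor ε X.len) :
    factorRetraction ε X.len (markedProj ε S (factorInclusion ε X.len x)) = 0 := by
  have hm : X.len ≠ 0 := fun hm => h (Or.inr hm)
  rw [markedProj_of_mem_of_ne (S := Finset.univ) (fun hS => h (Or.inl hS.symm))
    (factorInclusion_mem_markedTensors ε hm x), map_zero]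

/-- The modules `I^{⊗ S}` for reduced marked objects `([m], S)` map to `B^sym_m I`. -/
noncomputable def reducedToBsymI : reducedBsym ε ⟶ MarkedDeltaS.forgetReduced ⋙ BsymI ε where
  app X := ModuleCat.ofHom
    (factorRetraction ε X.obj.obj.len ∘ₗ (markedTensors ε X.obj.marked).subtype)
  naturality X Y f := by
    refine ModuleCat.hom_ext (LinearMap.ext fun z => factorInclusion_injective ε _ ?_)
    have h1 := factorInclusion_factorRetraction ε Y.property
      (bsymMap_mem_markedTensors ε f.hom z.2)
    have h2 := congrArg (fun φ => φ.hom (factorRetraction ε X.obj.obj.len z.1))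
      ((bsymInclusion ε).naturality (MarkedDeltaS.forgetReduced.map f))
    have h3 := congrArg (bsymMap k A f.hom.1) (factorInclusion_factorRetraction ε X.property z.2)
    exact h1.trans (h2.trans h3).symm

theorem bsymInclusion_reducedToBsymI (X : MarkedDeltaS.IsReduced.FullSubcategory) :
    (reducedToBsymI ε).app X ≫ (bsymInclusion ε).app (MarkedDeltaS.forgetReduced.obj X) =
      (markedInclusion ε).app X.obj :=
  ModuleCat.hom_ext (LinearMap.ext fun z => factorInclusion_factorRetraction ε X.property z.2)

/-- The composite map from the bar construction over reduced marked objects to that over `ΔS`. -/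
theorem barMap_bsymInclusion_comp (n : ℕ) :
    barMap (wideSubcategoryInclusion _) (bsymInclusion ε) n ∘ₗ
        barMap MarkedDeltaS.forgetReduced (reducedToBsymI ε) n =
      barMap MarkedDeltaS.forget (markedInclusion ε) n ∘ₗ
        barMap MarkedDeltaS.IsReduced.ι (𝟙 (reducedBsym ε)) n := by
  let γ : reducedBsym ε ⟶ (MarkedDeltaS.IsReduced.ι ⋙ MarkedDeltaS.forget) ⋙ Bsym k A :=
    Functor.whiskerLeft MarkedDeltaS.IsReduced.ι (markedInclusion ε)
  have h1 := barMap_comp MarkedDeltaS.IsReduced.ι (𝟙 (reducedBsym ε)) MarkedDeltaS.forget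
    (markedInclusion ε) γ (fun _ => (Category.id_comp _).symm) n
  have h2 := barMap_comp MarkedDeltaS.forgetReduced (reducedToBsymI ε)
    (wideSubcategoryInclusion (MorphismProperty.epimorphisms DeltaS)) (bsymInclusion ε) γ
    (fun X => (bsymInclusion_reducedToBsymI ε X).symm) n
  exact h2.symm.trans h1

theorem reducedBarMap_injective (n : ℕ) :
    Function.Injective (barMap MarkedDeltaS.forgetReduced (reducedToBsymI ε) n) := by
  refine Function.Injective.of_comp
    (f := barMap (wideSubcategoryInclusion _) (bsymInclusion ε) n) ?_
  rw [← LinearMap.coe_comp, barMap_bsymInclusion_comp, LinearMap.coe_comp]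
  exact (markedBarMap_bijective ε n).1.comp (reducedBarInclusion_injective ε n)

open Classical in
theorem lof_mem_range_reducedBarMap {n : ℕ} (σ : ComposableArrows EpiDeltaS n)
    (x : (BsymI ε).obj (σ.obj 0)) :
    DirectSum.lof k _ (fun σ : ComposableArrows EpiDeltaS n => (BsymI ε).obj (σ.obj 0)) σ x ∈
      LinearMap.range (barMap MarkedDeltaS.forgetReduced (reducedToBsymI ε) n) := by
  let m := (σ.obj 0).obj.len
  let p : Finset (Fin (m + 1)) → (BsymI ε).obj (σ.obj 0) := fun S =>
    factorRetraction ε m (markedProj ε S (factorInclusion ε m x))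
  have hp : x = ∑ S, p S := (sum_factorRetraction_markedProj ε m x).symm
  have hsum : DirectSum.lof k _ (fun σ : ComposableArrows EpiDeltaS n => (BsymI ε).obj (σ.obj 0)) σ
      x = ∑ S, DirectSum.lof k _
        (fun σ : ComposableArrows EpiDeltaS n => (BsymI ε).obj (σ.obj 0)) σ (p S) :=
    (congrArg _ hp).trans (map_sum (DirectSum.lof k _
        (fun σ : ComposableArrows EpiDeltaS n => (BsymI ε).obj (σ.obj 0)) σ) p Finset.univ)
  rw [hsum]
  refine Submodule.sum_mem _ fun S _ => ?_
  by_cases h : MarkedDeltaS.IsReduced ⟨(σ.obj 0).obj, S⟩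
  · let ν := MarkedDeltaS.liftEpiChain σ h
    let z : (reducedBsym ε).obj (ν.obj 0) := toMarked ε (ν.obj 0).obj (factorInclusion ε m x)
    have hν : ν ⋙ MarkedDeltaS.forgetReduced = σ := rfl
    have hz : ((reducedToBsymI ε).app (ν.obj 0)).hom z = p S :=
      congrArg (fun S => factorRetraction ε m (markedProj ε S (factorInclusion ε m x)))
        (MarkedDeltaS.liftChain_marked_zero
          (σ ⋙ wideSubcategoryInclusion (MorphismProperty.epimorphisms DeltaS)) S)
    have h1 := barMap_lof MarkedDeltaS.forgetReduced (reducedToBsymI ε) ν z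
    have h2 := lof_congr (F := BsymI ε) hν (heq_of_eq hz)
    exact ⟨_, h1.trans h2⟩
  · have h0 : p S = 0 := factorRetraction_markedProj_eq_zero ε h x
    rw [h0, map_zero]
    exact zero_mem _

/-- The complex `L^epi_*(A)` is the bar complex of the modules `I^{⊗ S}` over reduced marked
objects: the summand `A` of `B^sym I` at `[0]` splits as `k ⊕ I`, according to the two markings of
`[0]`. -/
theorem reducedBarMap_bijective (n : ℕ) :
    Function.Bijective (barMap MarkedDeltaS.forgetReduced (reducedToBsymI ε) n) := by
  classical
  refine ⟨reducedBarMap_injective ε n, LinearMap.range_eq_top.1 (eq_top_iff.2 fun z _ => ?_)⟩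
  induction z using DirectSum.induction_on with
  | zero => exact zero_mem _
  | of σ x => exact lof_mem_range_reducedBarMap ε σ x
  | add x y hx hy => exact add_mem (hx trivial) (hy trivial)

theorem lepiInclusion_injective (n : ℕ) :
    Function.Injective (barMap (wideSubcategoryInclusion _) (bsymInclusion ε) n) := by
  refine Function.Injective.of_comp_right (f := barMap (wideSubcategoryInclusion _)
    (bsymInclusion ε) n) (g := barMap MarkedDeltaS.forgetReduced (reducedToBsymI ε) n) ?_
    (reducedBarMap_bijective ε n).2
  rw [← LinearMap.coe_comp, barMap_bsymInclusion_comp, LinearMap.coe_comp]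
  exact (markedBarMap_bijective ε n).1.comp (reducedBarInclusion_injective ε n)

theorem exists_homotopyEquiv_hom_eq_lepiInclusion :
    ∃ e : HomotopyEquiv (Lepi ε) (L k A), e.hom = LepiInclusion ε := by
  have h1 : IsIso (barComplexMap MarkedDeltaS.forgetReduced (reducedToBsymI ε)) :=
    isIso_barComplexMap _ _ (reducedBarMap_bijective ε)
  have h2 : IsIso (barComplexMap MarkedDeltaS.forget (markedInclusion ε)) :=
    isIso_barComplexMap _ _ (markedBarMap_bijective ε)
  have h3 : barComplexMap MarkedDeltaS.forgetReduced (reducedToBsymI ε) ≫ LepiInclusion ε =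
      reducedBarInclusion ε ≫ barComplexMap MarkedDeltaS.forget (markedInclusion ε) := by
    ext1 n
    exact congrArg ModuleCat.ofHom (barMap_bsymInclusion_comp ε n)
  let e1 : barComplex (reducedBsym ε) ≅ barComplex (BsymI ε) :=
    asIso (barComplexMap MarkedDeltaS.forgetReduced (reducedToBsymI ε))
  let e2 : barComplex (markedBsym ε) ≅ barComplex (Bsym k A) :=
    asIso (barComplexMap MarkedDeltaS.forget (markedInclusion ε))
  refine ⟨(HomotopyEquiv.ofIso e1.symm).trans ((reducedBarHomotopyEquiv ε).trans
    (HomotopyEquiv.ofIso e2)), ?_⟩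
  exact (Iso.inv_comp_eq e1).2 h3.symm

end EpiBar

/-! ### Nerves of coslice categories -/

section CosliceNerve

variable {C : Type} [SmallCategory C]

/-- The `n`-simplices `c ⟶ c₀ ⟶ ⋯ ⟶ c_n` of the nerve of the coslice category `c / C`. -/
abbrev CosliceChain (c : C) (n : ℕ) : Type := (σ : ComposableArrows C n) × (c ⟶ σ.obj 0)

namespace CosliceChain

variable {c d : C}

/-- The action of a map of simplices. -/
def pullback {S T : SimplexCategory} (θ : S ⟶ T) (x : CosliceChain c T.len) :
    CosliceChain c S.len :=
  ⟨chainPullback θ x.1, x.2 ≫ chainStep θ x.1⟩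

/-- The action of a morphism of `C` by precomposition. -/
def precomp (f : d ⟶ c) {n : ℕ} (x : CosliceChain c n) : CosliceChain d n :=
  ⟨x.1, f ≫ x.2⟩

theorem pullback_id {S : SimplexCategory} (x : CosliceChain c S.len) : pullback (𝟙 S) x = x := by
  refine Sigma.ext rfl (heq_of_eq ?_)
  change x.2 ≫ x.1.map (𝟙 _) = x.2
  rw [x.1.map_id, Category.comp_id]

theorem pullback_comp {S T U : SimplexCategory} (θ : S ⟶ T) (η : T ⟶ U)
    (x : CosliceChain c U.len) : pullback (θ ≫ η) x = pullback θ (pullback η x) := by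
  refine Sigma.ext rfl (heq_of_eq ?_)
  refine Eq.trans ?_ (Category.assoc _ _ _).symm
  exact congrArg (x.2 ≫ ·) (x.1.map_comp (homOfLE _) (homOfLE _))

theorem precomp_id {n : ℕ} (x : CosliceChain c n) : precomp (𝟙 c) x = x :=
  Sigma.ext rfl (heq_of_eq (Category.id_comp x.2))

theorem precomp_comp {e : C} (f : d ⟶ c) (g : e ⟶ d) {n : ℕ} (x : CosliceChain c n) :
    precomp (g ≫ f) x = precomp g (precomp f x) :=
  Sigma.ext rfl (heq_of_eq (Category.assoc g f x.2))

theorem pullback_precomp {S T : SimplexCategory} (θ : S ⟶ T) (f : d ⟶ c)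
    (x : CosliceChain c T.len) : pullback θ (precomp f x) = precomp f (pullback θ x) :=
  Sigma.ext rfl (heq_of_eq (Category.assoc f x.2 _))

/-- The cone on a map of simplices: it fixes the initial vertex and is `θ` on the others. -/
def cone {S T : SimplexCategory} (θ : S ⟶ T) :
    SimplexCategory.mk (S.len + 1) ⟶ SimplexCategory.mk (T.len + 1) :=
  SimplexCategory.mkHom ⟨Fin.cases 0 fun i => (θ.toOrderHom i).succ, fun i j h => by
    induction i using Fin.cases with
    | zero => exact Fin.zero_le _
    | succ i =>
      induction j using Fin.cases with
      | zero => exact absurd h (by simp)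
      | succ j => exact Fin.succ_le_succ_iff.2 (θ.toOrderHom.monotone (Fin.succ_le_succ_iff.1 h))⟩

/-- The extra degeneracy, which adds the vertex `𝟙 c` of the nerve of `c / C`. -/
def cons {n : ℕ} (x : CosliceChain c n) : CosliceChain c (n + 1) :=
  ⟨x.1.precomp x.2, 𝟙 c⟩

theorem precomp_map_zero_succ {n : ℕ} (σ : ComposableArrows C n) (f : c ⟶ σ.left)
    (j : Fin (n + 1)) : (σ.precomp f).map (homOfLE (Fin.zero_le j.succ)) =
      (f ≫ σ.map (homOfLE (Fin.zero_le j)) : c ⟶ σ.obj j) := by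
  obtain ⟨_ | j, hj⟩ := j
  · exact ((congrArg (f ≫ ·) (σ.map_id 0)).trans (Category.comp_id f)).symm
  · rfl

theorem pullback_cone_cons {S T : SimplexCategory} (θ : S ⟶ T) (x : CosliceChain c T.len) :
    pullback (cone θ) (cons x) = cons (pullback θ x) := by
  have h : chainPullback (cone θ) (x.1.precomp x.2) =
      (chainPullback θ x.1).precomp (x.2 ≫ chainStep θ x.1) := by
    refine ComposableArrows.ext_succ rfl rfl ?_
    refine Eq.trans (b := x.2 ≫ chainStep θ x.1)
      (precomp_map_zero_succ x.1 x.2 (θ.toOrderHom 0)) ?_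
    exact ((Category.id_comp _).trans (Category.comp_id _)).symm
  refine Sigma.ext h ?_
  exact heq_of_eq ((Category.id_comp _).trans ((x.1.precomp x.2).map_id 0))

theorem cone_δ {n : ℕ} (i : Fin (n + 2)) :
    cone (SimplexCategory.δ i) = SimplexCategory.δ i.succ := by
  ext j
  induction j using Fin.cases with
  | zero => simp [cone, SimplexCategory.δ]
  | succ j => simp [cone, SimplexCategory.δ]

theorem cone_σ {n : ℕ} (i : Fin (n + 1)) :
    cone (SimplexCategory.σ i) = SimplexCategory.σ i.succ := by
  ext j
  induction j using Fin.cases with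
  | zero => simp [cone, SimplexCategory.σ]
  | succ j => simp [cone, SimplexCategory.σ]

theorem pullback_δ_zero_cons {n : ℕ} (x : CosliceChain c n) :
    pullback (SimplexCategory.δ (0 : Fin (n + 2))) (cons x) = x := by
  refine Sigma.ext rfl (heq_of_eq ?_)
  exact Category.id_comp _

theorem pullback_δ_one_cons (x : CosliceChain c 0) :
    pullback (SimplexCategory.δ (1 : Fin 2)) (cons x) = ⟨ComposableArrows.mk₀ c, 𝟙 c⟩ :=
  Sigma.ext (ComposableArrows.ext₀ rfl) (heq_of_eq (Category.id_comp (𝟙 c)))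

end CosliceChain

variable (C) in
/-- The contravariant functor `c ↦ N(c / C)` with values in simplicial sets, as a simplicial
object. -/
def cosliceNerve : SimplicialObject (Cᵒᵖ ⥤ Type) where
  obj S :=
    { obj c := CosliceChain c.unop S.unop.len
      map f := TypeCat.ofHom (CosliceChain.precomp f.unop)
      map_id c := by
        refine ConcreteCategory.hom_ext _ _ fun x => ?_
        exact CosliceChain.precomp_id x
      map_comp f g := by
        refine ConcreteCategory.hom_ext _ _ fun x => ?_
        exact CosliceChain.precomp_comp f.unop g.unop x }
  map θ :=
    { app c := TypeCat.ofHom (CosliceChain.pullback θ.unop)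
      naturality c d f := by
        refine ConcreteCategory.hom_ext _ _ fun x => ?_
        exact CosliceChain.pullback_precomp θ.unop f.unop x }
  map_id S := by
    refine NatTrans.ext (funext fun c => ConcreteCategory.hom_ext _ _ fun x => ?_)
    exact CosliceChain.pullback_id x
  map_comp θ η := by
    refine NatTrans.ext (funext fun c => ConcreteCategory.hom_ext _ _ fun x => ?_)
    exact CosliceChain.pullback_comp _ _ x

variable (C) in
/-- The augmentation of `cosliceNerve` to the one-point functor. -/
def augmentedCosliceNerve : SimplicialObject.Augmented (Cᵒᵖ ⥤ Type) where
  left := cosliceNerve C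
  right := (Functor.const Cᵒᵖ).obj PUnit
  hom := { app S := { app c := TypeCat.ofHom fun _ => PUnit.unit } }

/-- The nerve of `c / C` is contractible, since `𝟙 c` is an initial object. -/
def cosliceNerveExtraDegeneracy (c : C) : SimplicialObject.Augmented.ExtraDegeneracy
    (((SimplicialObject.Augmented.whiskering _ _).obj ((evaluation Cᵒᵖ Type).obj (op c))).obj
      (augmentedCosliceNerve C)) where
  s' := TypeCat.ofHom fun _ => (⟨ComposableArrows.mk₀ c, 𝟙 c⟩ : CosliceChain c 0)
  s n := TypeCat.ofHom (CosliceChain.cons (c := c) (n := n))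
  s'_comp_ε := rfl
  s₀_comp_δ₁ := by
    refine ConcreteCategory.hom_ext _ _ fun x => ?_
    exact CosliceChain.pullback_δ_one_cons (c := c) x
  s_comp_δ₀ n := by
    refine ConcreteCategory.hom_ext _ _ fun x => ?_
    exact CosliceChain.pullback_δ_zero_cons (c := c) x
  s_comp_δ n i := by
    refine ConcreteCategory.hom_ext _ _ fun x => ?_
    refine Eq.trans ?_ (CosliceChain.pullback_cone_cons (c := c) (SimplexCategory.δ i) x)
    rw [CosliceChain.cone_δ]
    rfl
  s_comp_σ n i := by
    refine ConcreteCategory.hom_ext _ _ fun x => ?_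
    refine Eq.trans ?_ (CosliceChain.pullback_cone_cons (c := c) (SimplexCategory.σ i) x)
    rw [CosliceChain.cone_σ]
    rfl

end CosliceNerve

/-! ### Augmented alternating face map complexes -/

section AlternatingFaceMapComplex

open AlgebraicTopology

variable {V W : Type*} [Category* V] [Category* W] [Preadditive V] [Preadditive W]
  (F : V ⥤ W) [F.Additive]

/-- An additive functor commutes with the formation of alternating face map complexes. -/
noncomputable def mapAlternatingFaceMapComplexIso (X : SimplicialObject V) :
    (F.mapHomologicalComplex _).obj ((alternatingFaceMapComplex V).obj X) ≅
      (alternatingFaceMapComplex W).obj (((SimplicialObject.whiskering V W).obj F).obj X) :=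
  HomologicalComplex.Hom.isoOfComponents (fun _ => Iso.refl _) (by
    rintro _ j rfl
    simp only [alternatingFaceMapComplex_obj_d, Functor.mapHomologicalComplex_obj_d,
      AlternatingFaceMapComplex.objD, Functor.map_sum, Functor.map_zsmul]
    exact (Category.id_comp _).trans (Category.comp_id _).symm)

/-- The previous isomorphism is compatible with the augmentations. -/
theorem map_alternatingFaceMapComplex_augmentation [Limits.HasZeroObject V]
    [Limits.HasZeroObject W] (X : SimplicialObject.Augmented V) :
    (F.mapHomologicalComplex _).map (AlternatingFaceMapComplex.ε.app X) ≫
        (HomologicalComplex.singleMapHomologicalComplex F _ 0).hom.app X.right =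
      (mapAlternatingFaceMapComplexIso F X.left).hom ≫ AlternatingFaceMapComplex.ε.app
        (((SimplicialObject.Augmented.whiskering V W).obj F).obj X) := by
  apply HomologicalComplex.to_single_hom_ext
  change F.map ((AlternatingFaceMapComplex.ε.app X).f 0) ≫
    ((HomologicalComplex.singleMapHomologicalComplex F (ComplexShape.down ℕ) 0).hom.app
      X.right).f 0 = 𝟙 _ ≫ (AlternatingFaceMapComplex.ε.app
        (((SimplicialObject.Augmented.whiskering V W).obj F).obj X)).f 0
  rw [HomologicalComplex.singleMapHomologicalComplex_hom_app_self,
    AlternatingFaceMapComplex.ε_app_f_zero, AlternatingFaceMapComplex.ε_app_f_zero]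
  have h : F.map (HomologicalComplex.singleObjXSelf (ComplexShape.down ℕ) 0 X.right).hom ≫
      (HomologicalComplex.singleObjXSelf (ComplexShape.down ℕ) 0 (F.obj X.right)).inv = 𝟙 _ := by
    rw [ChainComplex.single₀ObjXSelf, ChainComplex.single₀ObjXSelf]
    exact (Category.comp_id _).trans (F.map_id _)
  exact (congrArg (F.map (X.hom.app (op (SimplexCategory.mk 0))) ≫ ·) h).trans
    (Category.id_comp _).symm

end AlternatingFaceMapComplex

/-! ### The bar resolution of the trivial functor -/

section BarResolution

variable (k : Type u) [CommRing k]

/-- The free module functor on small types. -/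
noncomputable def freeModule : Type ⥤ ModuleCat.{u} k where
  obj X := ModuleCat.of k (X →₀ k)
  map f := ModuleCat.ofHom (Finsupp.lmapDomain k k f)
  map_id _ := ModuleCat.hom_ext (Finsupp.lmapDomain_id k k)
  map_comp f g := ModuleCat.hom_ext (Finsupp.lmapDomain_comp k k f g)

variable (C : Type) [SmallCategory C]

/-- The augmented simplicial object `k[N(c / C)]` of contravariant functors on `C`. -/
noncomputable def augmentedBarResolution :
    SimplicialObject.Augmented (Cᵒᵖ ⥤ ModuleCat.{u} k) :=
  ((SimplicialObject.Augmented.whiskering _ _).obj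
    ((Functor.whiskeringRight Cᵒᵖ Type (ModuleCat.{u} k)).obj (freeModule k))).obj
      (augmentedCosliceNerve C)

/-- The simplicial object of contravariant functors with value `k[N(c / C)]` at `c`. -/
noncomputable abbrev barResolution : SimplicialObject (Cᵒᵖ ⥤ ModuleCat.{u} k) :=
  (augmentedBarResolution k C).left

variable {C} in
/-- The extra degeneracy of the value of the bar resolution at `c`. -/
noncomputable def barResolutionExtraDegeneracy (c : Cᵒᵖ) :
    SimplicialObject.Augmented.ExtraDegeneracy
      (((SimplicialObject.Augmented.whiskering _ _).obj
        ((evaluation Cᵒᵖ (ModuleCat.{u} k)).obj c)).obj (augmentedBarResolution k C)) :=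
  (cosliceNerveExtraDegeneracy c.unop).map (freeModule k)

open AlgebraicTopology in
instance quasiIso_barResolution :
    QuasiIso (AlternatingFaceMapComplex.ε.app (augmentedBarResolution k C)) := by
  rw [HomologicalComplex.quasiIso_iff_evaluation]
  intro c
  have h : QuasiIso (AlternatingFaceMapComplex.ε.app
    (((SimplicialObject.Augmented.whiskering _ _).obj
        ((evaluation Cᵒᵖ (ModuleCat.{u} k)).obj c)).obj (augmentedBarResolution k C))) :=
    (barResolutionExtraDegeneracy k c).homotopyEquiv.quasiIso_hom
  refine (quasiIso_iff_of_arrow_mk_iso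
    ((((evaluation Cᵒᵖ (ModuleCat.{u} k)).obj c).mapHomologicalComplex _).map
      (AlternatingFaceMapComplex.ε.app (augmentedBarResolution k C))) _
      (Arrow.isoMk (mapAlternatingFaceMapComplexIso _ _)
        ((HomologicalComplex.singleMapHomologicalComplex _ _ 0).app _)
        (map_alternatingFaceMapComplex_augmentation ((evaluation Cᵒᵖ (ModuleCat.{u} k)).obj c)
          (augmentedBarResolution k C)).symm)).2 h

variable {k C}

theorem lift_single_one {X M : Type*} [AddCommGroup M] [Module k M] (φ : X → M) (x : X) :
    Finsupp.lift M k X φ (Finsupp.single x 1) = φ x := by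
  simp

/-- The `n`-th term of the bar resolution is the sum, over the chains `c₀ ⟶ ⋯ ⟶ c_n`, of the free
functors on the representable functors at `c₀`, so a map out of it is given by elements of the
values at the `c₀`. -/
noncomputable def barResolutionDesc (S : SimplexCategoryᵒᵖ) {E : Cᵒᵖ ⥤ ModuleCat.{u} k}
    (y : ∀ σ : ComposableArrows C S.unop.len, E.obj (op (σ.obj 0))) :
    (barResolution k C).obj S ⟶ E where
  app c := ModuleCat.ofHom (Finsupp.lift (E.obj c) k (CosliceChain c.unop S.unop.len)
    fun x => (E.map x.2.op).hom (y x.1))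
  naturality c d u := by
    refine ModuleCat.hom_ext (Finsupp.lhom_ext' fun (x : CosliceChain c.unop S.unop.len) =>
      LinearMap.ext_ring ?_)
    change Finsupp.lift (E.obj d) k (CosliceChain d.unop S.unop.len)
        (fun x => (E.map x.2.op).hom (y x.1))
        (Finsupp.mapDomain (CosliceChain.precomp u.unop) (Finsupp.single x 1)) =
      (E.map u).hom (Finsupp.lift (E.obj c) k (CosliceChain c.unop S.unop.len)
        (fun x => (E.map x.2.op).hom (y x.1)) (Finsupp.single x 1))
    rw [Finsupp.mapDomain_single, lift_single_one, lift_single_one]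
    exact congrArg (fun φ => φ.hom (y x.1)) (E.map_comp x.2.op u)

theorem barResolutionDesc_app_single (S : SimplexCategoryᵒᵖ) {E : Cᵒᵖ ⥤ ModuleCat.{u} k}
    (y : ∀ σ : ComposableArrows C S.unop.len, E.obj (op (σ.obj 0))) (c : Cᵒᵖ)
    (x : CosliceChain c.unop S.unop.len) :
    ((barResolutionDesc S y).app c).hom (Finsupp.single x 1) = (E.map x.2.op).hom (y x.1) :=
  lift_single_one _ x

/-- A map out of the bar resolution is determined by its values at the chains `c₀ = c₀ ⟶ ⋯ ⟶ c_n`,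
by the Yoneda lemma. -/
theorem barResolution_hom_app_single {S : SimplexCategoryᵒᵖ} {E : Cᵒᵖ ⥤ ModuleCat.{u} k}
    (f : (barResolution k C).obj S ⟶ E) (c : Cᵒᵖ) (x : CosliceChain c.unop S.unop.len) :
    (f.app c).hom (Finsupp.single x 1) = (E.map x.2.op).hom ((f.app (op (x.1.obj 0))).hom
      (Finsupp.single (⟨x.1, 𝟙 _⟩ : CosliceChain (x.1.obj 0) S.unop.len) 1)) := by
  refine Eq.trans ?_ (congrArg (fun φ => φ.hom
    (Finsupp.single (⟨x.1, 𝟙 _⟩ : CosliceChain (x.1.obj 0) S.unop.len) 1)) (f.naturality x.2.op))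
  refine congrArg (f.app c).hom (Eq.symm ?_)
  refine (Finsupp.mapDomain_single (f := CosliceChain.precomp x.2)).trans ?_
  exact congrArg (fun z : CosliceChain c.unop S.unop.len => Finsupp.single z (1 : k))
    (Sigma.ext rfl (heq_of_eq (Category.comp_id x.2)))

variable (k C) in
instance projective_barResolution (S : SimplexCategoryᵒᵖ) :
    Projective ((barResolution k C).obj S) where
  factors {E X} f e _ := by
    have he : ∀ c, Function.Surjective (e.app c).hom := fun c =>
      (ModuleCat.epi_iff_surjective _).1 inferInstance
    choose y hy using fun σ : ComposableArrows C S.unop.len =>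
      he (op (σ.obj 0)) ((f.app (op (σ.obj 0))).hom
        (Finsupp.single (⟨σ, 𝟙 _⟩ : CosliceChain (σ.obj 0) S.unop.len) 1))
    refine ⟨barResolutionDesc S y, NatTrans.ext (funext fun c => ModuleCat.hom_ext
      (Finsupp.lhom_ext' fun (x : CosliceChain c.unop S.unop.len) => LinearMap.ext_ring ?_))⟩
    refine Eq.trans ?_ (barResolution_hom_app_single f c x).symm
    rw [← hy]
    exact (congrArg (e.app c).hom (barResolutionDesc_app_single S y c x)).trans
      (congrArg (fun φ => φ.hom (y x.1)) (e.naturality x.2.op))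

end BarResolution

/-! ### `Tor` as the homology of the bar complex -/

section BarTor

variable {k : Type u} [CommRing k] {C : Type} [SmallCategory C]

open Classical in
/-- The class of `x ⊗ y` in `F ⊗_C G`, for `x ∈ F(c)` and `y ∈ G(c)`. -/
noncomputable def tensorMk (F : Cᵒᵖ ⥤ ModuleCat.{u} k) (G : C ⥤ ModuleCat.{u} k) (c : C) :
    F.obj (op c) →ₗ[k] G.obj c →ₗ[k] (tensorFunctor G).obj F :=
  (TensorProduct.mk k (F.obj (op c)) (G.obj c)).compr₂ ((tensorRelations F G).mkQ ∘ₗ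
    DirectSum.lof k C (fun c => (F.obj (op c) : Type u) ⊗[k] (G.obj c : Type u)) c)

theorem tensorMk_map (F : Cᵒᵖ ⥤ ModuleCat.{u} k) (G : C ⥤ ModuleCat.{u} k) {c d : C}
    (f : c ⟶ d) (x : F.obj (op d)) (y : G.obj c) :
    tensorMk F G c ((F.map f.op).hom x) y = tensorMk F G d x ((G.map f).hom y) :=
  (Submodule.Quotient.eq (tensorRelations F G)).2
    (Submodule.subset_span ⟨c, d, f, x, y, rfl⟩)

theorem tensorFunctor_hom_ext {F : Cᵒᵖ ⥤ ModuleCat.{u} k} {G : C ⥤ ModuleCat.{u} k}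
    {M : Type*} [AddCommGroup M] [Module k M] {φ ψ : (tensorFunctor G).obj F →ₗ[k] M}
    (h : ∀ c, (tensorMk F G c).compr₂ φ = (tensorMk F G c).compr₂ ψ) : φ = ψ := by
  classical
  refine Submodule.linearMap_qext _ (DirectSum.linearMap_ext _ fun c => TensorProduct.ext ?_)
  exact h c

theorem tensorFunctor_map_tensorMk {F F' : Cᵒᵖ ⥤ ModuleCat.{u} k} (α : F ⟶ F')
    (G : C ⥤ ModuleCat.{u} k) (c : C) (x : F.obj (op c)) (y : G.obj c) :
    ((tensorFunctor G).map α).hom (tensorMk F G c x y) =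
      tensorMk F' G c ((α.app (op c)).hom x) y := by
  classical
  exact congrArg (tensorRelations F' G).mkQ (tensorMapAux_lof α G c x y)

open Classical in
/-- A family of bilinear maps `F(c) × G(c) → M` that is compatible with the actions of `C` gives a
linear map out of `F ⊗_C G`. -/
noncomputable def tensorDesc {F : Cᵒᵖ ⥤ ModuleCat.{u} k} {G : C ⥤ ModuleCat.{u} k}
    {M : Type*} [AddCommGroup M] [Module k M]
    (φ : ∀ c, F.obj (op c) →ₗ[k] G.obj c →ₗ[k] M)
    (hφ : ∀ ⦃c d : C⦄ (f : c ⟶ d) (x : F.obj (op d)) (y : G.obj c),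
      φ c ((F.map f.op).hom x) y = φ d x ((G.map f).hom y)) :
    (tensorFunctor G).obj F →ₗ[k] M :=
  (tensorRelations F G).liftQ (DirectSum.toModule k C M fun c => TensorProduct.lift (φ c)) <| by
    refine Submodule.span_le.2 ?_
    rintro _ ⟨c, d, f, x, y, rfl⟩
    refine LinearMap.mem_ker.2 ?_
    rw [map_sub, DirectSum.toModule_lof, DirectSum.toModule_lof, TensorProduct.lift.tmul,
      TensorProduct.lift.tmul, hφ, sub_self]

theorem tensorDesc_tensorMk {F : Cᵒᵖ ⥤ ModuleCat.{u} k} {G : C ⥤ ModuleCat.{u} k}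
    {M : Type*} [AddCommGroup M] [Module k M]
    (φ : ∀ c, F.obj (op c) →ₗ[k] G.obj c →ₗ[k] M)
    (hφ : ∀ ⦃c d : C⦄ (f : c ⟶ d) (x : F.obj (op d)) (y : G.obj c),
      φ c ((F.map f.op).hom x) y = φ d x ((G.map f).hom y)) (c : C) (x : F.obj (op c))
    (y : G.obj c) : tensorDesc φ hφ (tensorMk F G c x y) = φ c x y := by
  classical
  refine (DirectSum.toModule_lof (φ := fun c => TensorProduct.lift (φ c)) k c (x ⊗ₜ[k] y)).trans ?_
  exact TensorProduct.lift.tmul x y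

variable (G : C ⥤ ModuleCat.{u} k)

open Classical in
/-- The bilinear map that takes a chain `c ⟶ c₀ ⟶ ⋯ ⟶ c_n` and `y ∈ G(c)` to the image of `y` in
the summand `G(c₀)` of the chain `c₀ ⟶ ⋯ ⟶ c_n`. -/
noncomputable def tensorBarPairing (n : ℕ) (c : C) : (CosliceChain c n →₀ k) →ₗ[k]
    G.obj c →ₗ[k] ⨁ σ : ComposableArrows C n, G.obj (σ.obj 0) :=
  Finsupp.lift _ k _ fun x =>
    DirectSum.lof k _ (fun σ : ComposableArrows C n => G.obj (σ.obj 0)) x.1 ∘ₗ (G.map x.2).hom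

open Classical in
theorem tensorBarPairing_single (n : ℕ) (c : C) (x : CosliceChain c n) (y : G.obj c) :
    tensorBarPairing G n c (Finsupp.single x 1) y =
      DirectSum.lof k _ (fun σ : ComposableArrows C n => G.obj (σ.obj 0)) x.1
        ((G.map x.2).hom y) :=
  LinearMap.congr_fun (lift_single_one _ x) y

theorem tensorBarPairing_precomp (n : ℕ) ⦃c d : C⦄ (f : c ⟶ d) (x : CosliceChain d n →₀ k)
    (y : G.obj c) : tensorBarPairing G n c (Finsupp.mapDomain (CosliceChain.precomp f) x) y =
      tensorBarPairing G n d x ((G.map f).hom y) := by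
  classical
  suffices h : (tensorBarPairing G n c).flip y ∘ₗ
      Finsupp.lmapDomain k k (CosliceChain.precomp f) =
        (tensorBarPairing G n d).flip ((G.map f).hom y) from LinearMap.congr_fun h x
  refine Finsupp.lhom_ext' fun x => LinearMap.ext_ring ?_
  change tensorBarPairing G n c (Finsupp.mapDomain (CosliceChain.precomp f)
    (Finsupp.single x 1)) y = tensorBarPairing G n d (Finsupp.single x 1) ((G.map f).hom y)
  rw [Finsupp.mapDomain_single, tensorBarPairing_single, tensorBarPairing_single]
  exact congrArg (DirectSum.lof k _ (fun σ : ComposableArrows C n => G.obj (σ.obj 0)) x.1)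
    (congrArg (fun φ => φ.hom y) (G.map_comp f x.2))

open Classical in
/-- The map from the bar construction of `G` to the tensor product of the bar resolution with `G`:
an element `y` of the summand `G(c₀)` of a chain `σ` goes to `(c₀ = c₀ ⟶ ⋯ ⟶ c_n) ⊗ y`. -/
noncomputable def barToTensor (S : SimplexCategoryᵒᵖ) :
    (⨁ σ : ComposableArrows C S.unop.len, G.obj (σ.obj 0)) →ₗ[k]
      (tensorFunctor G).obj ((barResolution k C).obj S) :=
  DirectSum.toModule k _ _ fun σ => tensorMk ((barResolution k C).obj S) G (σ.obj 0)
    (Finsupp.single (⟨σ, 𝟙 _⟩ : CosliceChain (σ.obj 0) S.unop.len) 1)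

open Classical in
theorem barToTensor_lof (S : SimplexCategoryᵒᵖ) (σ : ComposableArrows C S.unop.len)
    (y : G.obj (σ.obj 0)) :
    barToTensor G S (DirectSum.lof k _
        (fun σ : ComposableArrows C S.unop.len => G.obj (σ.obj 0)) σ y) =
      tensorMk ((barResolution k C).obj S) G (σ.obj 0)
        (Finsupp.single (⟨σ, 𝟙 _⟩ : CosliceChain (σ.obj 0) S.unop.len) 1) y :=
  DirectSum.toModule_lof (φ := fun σ : ComposableArrows C S.unop.len =>
    tensorMk ((barResolution k C).obj S) G (σ.obj 0)
      (Finsupp.single (⟨σ, 𝟙 _⟩ : CosliceChain (σ.obj 0) S.unop.len) 1)) k σ y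

open Classical in
/-- The generator of a chain `c ⟶ c₀ ⟶ ⋯ ⟶ c_n` of the bar resolution is the image of the generator
of `c₀ = c₀ ⟶ ⋯ ⟶ c_n`, so `barToTensor` is surjective. -/
theorem tensorMk_single (S : SimplexCategoryᵒᵖ) {c : C} (x : CosliceChain c S.unop.len)
    (y : G.obj c) :
    tensorMk ((barResolution k C).obj S) G c (Finsupp.single x 1) y =
      barToTensor G S (DirectSum.lof k _
        (fun σ : ComposableArrows C S.unop.len => G.obj (σ.obj 0)) x.1 ((G.map x.2).hom y)) := by
  refine Eq.trans ?_ (barToTensor_lof G S x.1 _).symm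
  refine Eq.trans ?_ (tensorMk_map ((barResolution k C).obj S) G x.2 _ y)
  refine congrArg (fun z => tensorMk ((barResolution k C).obj S) G c z y) ?_
  exact barResolution_hom_app_single (𝟙 ((barResolution k C).obj S)) (op c) x

/-- The tensor product of the `n`-th term of the bar resolution with `G` is the sum of the modules
`G(c₀)`. -/
noncomputable def tensorBarResolutionEquiv (S : SimplexCategoryᵒᵖ) :
    (⨁ σ : ComposableArrows C S.unop.len, G.obj (σ.obj 0)) ≃ₗ[k]
      (tensorFunctor G).obj ((barResolution k C).obj S) :=
  LinearEquiv.ofLinearMap (barToTensor G S)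
    (tensorDesc (F := (barResolution k C).obj S) (tensorBarPairing G S.unop.len)
      (tensorBarPairing_precomp G S.unop.len))
    (by
      classical
      refine tensorFunctor_hom_ext fun c => Finsupp.lhom_ext' fun
        (x : CosliceChain c S.unop.len) => LinearMap.ext_ring (LinearMap.ext fun y => ?_)
      refine Eq.trans ?_ (tensorMk_single G S x y).symm
      refine congrArg (barToTensor G S) ?_
      refine (tensorDesc_tensorMk (F := (barResolution k C).obj S)
        (tensorBarPairing G S.unop.len) (tensorBarPairing_precomp G S.unop.len) c _ y).trans ?_
      exact tensorBarPairing_single G S.unop.len c x y)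
    (by
      classical
      refine DirectSum.linearMap_ext _ fun σ => LinearMap.ext fun y => ?_
      refine (congrArg (tensorDesc (F := (barResolution k C).obj S)
        (tensorBarPairing G S.unop.len) (tensorBarPairing_precomp G S.unop.len))
        (barToTensor_lof G S σ y)).trans ?_
      refine (tensorDesc_tensorMk (F := (barResolution k C).obj S)
        (tensorBarPairing G S.unop.len) (tensorBarPairing_precomp G S.unop.len) _ _ y).trans ?_
      refine (tensorBarPairing_single G S.unop.len _ ⟨σ, 𝟙 _⟩ y).trans ?_
      exact congrArg (DirectSum.lof k _ (fun σ : ComposableArrows C S.unop.len =>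
        G.obj (σ.obj 0)) σ) (congrArg (fun φ => φ.hom y) (G.map_id _)))

theorem barToTensor_naturality {S T : SimplexCategoryᵒᵖ} (θ : S ⟶ T) :
    barToTensor G T ∘ₗ barSimplicialAction G θ.unop =
      ((tensorFunctor G).map ((barResolution k C).map θ)).hom ∘ₗ barToTensor G S := by
  classical
  refine DirectSum.linearMap_ext _ fun σ => LinearMap.ext fun y => ?_
  refine (congrArg (barToTensor G T) (barSimplicialAction_lof G θ.unop σ y)).trans ?_
  refine Eq.trans ?_ (congrArg ((tensorFunctor G).map ((barResolution k C).map θ)).hom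
    (barToTensor_lof G S σ y)).symm
  refine Eq.trans ?_ (tensorFunctor_map_tensorMk ((barResolution k C).map θ) G _ _ y).symm
  refine (tensorMk_single G T (⟨chainPullback θ.unop σ, chainStep θ.unop σ⟩ :
    CosliceChain (σ.obj 0) T.unop.len) y).symm.trans ?_
  refine congrArg (fun z => tensorMk ((barResolution k C).obj T) G (σ.obj 0) z y) (Eq.symm ?_)
  refine (Finsupp.mapDomain_single (f := CosliceChain.pullback θ.unop)).trans ?_
  exact congrArg (fun z : CosliceChain (σ.obj 0) T.unop.len => Finsupp.single z (1 : k))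
    (Sigma.ext rfl (heq_of_eq (Category.id_comp _)))

/-- The tensor product of the bar resolution with `G` is the bar construction of `G`. -/
noncomputable def tensorBarResolutionIso :
    barSimplicial G ≅
      ((SimplicialObject.whiskering _ _).obj (tensorFunctor G)).obj (barResolution k C) :=
  NatIso.ofComponents (fun S => (tensorBarResolutionEquiv G S).toModuleIso) fun θ =>
    ModuleCat.hom_ext (barToTensor_naturality G θ)

variable (k C) in
/-- The bar resolution, as a projective resolution of the functor with value the free module on a
point. -/
noncomputable def barProjectiveResolution :
    ProjectiveResolution (augmentedBarResolution k C).right where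
  complex := (AlgebraicTopology.alternatingFaceMapComplex _).obj (barResolution k C)
  projective n := projective_barResolution k C (op (SimplexCategory.mk n))
  π := AlgebraicTopology.AlternatingFaceMapComplex.ε.app (augmentedBarResolution k C)
  quasiIso := quasiIso_barResolution k C

/-- `Tor^C_n(k, G)` is the homology of the bar complex of `G`. -/
theorem nonempty_functorTor_iso_homology_barComplex (n : ℕ) :
    Nonempty (functorTor ((Functor.const Cᵒᵖ).obj (ModuleCat.of k k)) G n ≅
      (barComplex G).homology n) := by
  let e : (Functor.const Cᵒᵖ).obj (ModuleCat.of k k) ≅ (augmentedBarResolution k C).right :=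
    (Functor.const Cᵒᵖ).mapIso (Finsupp.uniqueLinearEquiv k k PUnit.unit).symm.toModuleIso ≪≫
      (Functor.constComp Cᵒᵖ PUnit (freeModule k)).symm
  exact ⟨((tensorFunctor G).leftDerived n).mapIso e ≪≫
    (barProjectiveResolution k C).isoLeftDerivedObj (tensorFunctor G) n ≪≫
    (HomologicalComplex.homologyFunctor _ _ n).mapIso
      (mapAlternatingFaceMapComplexIso (tensorFunctor G) (barResolution k C) ≪≫
        (AlgebraicTopology.alternatingFaceMapComplex _).mapIso
          (tensorBarResolutionIso G).symm)⟩

end BarTor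

theorem nonempty_HS_iso_homology_Lepi {k A : Type u} [CommRing k] [Ring A] [Algebra k A]
    (ε : A →ₐ[k] k) (n : ℕ) : Nonempty (HS k A n ≅ (Lepi ε).homology n) := by
  obtain ⟨e⟩ := nonempty_functorTor_iso_homology_barComplex (Bsym k A) n
  obtain ⟨f, -⟩ := exists_homotopyEquiv_hom_eq_lepiInclusion ε
  exact ⟨e ≪≫ (f.toHomologyIso n).symm⟩

end SymmetricHomology

theorem mainTheorem6 {k A : Type u} [CommRing k] [Ring A] [Algebra k A] (ε : A →ₐ[k] k) :
    -- `L^epi_*(A)` is a subcomplex of `L_*(A)`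
    (∀ p : ℕ, Function.Injective ((SymmetricHomology.LepiInclusion ε).f p)) ∧
    -- the inclusion is a chain homotopy equivalence
    (∃ e : HomotopyEquiv (SymmetricHomology.Lepi ε) (SymmetricHomology.L k A),
      e.hom = SymmetricHomology.LepiInclusion ε) ∧
    -- `HS_*(A) = H_*(L^epi_*(A))`
    (∀ n : ℕ, Nonempty (SymmetricHomology.HS k A n ≅ (SymmetricHomology.Lepi ε).homology n)) :=
  ⟨SymmetricHomology.lepiInclusion_injective ε,
    SymmetricHomology.exists_homotopyEquiv_hom_eq_lepiInclusion ε,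
    SymmetricHomology.nonempty_HS_iso_homology_Lepi ε⟩
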